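/- Let $q$ be a prime power, let $\mathbb F_q$ be a finite field with $q$ elements, and let $0\le a<1$. Choose a non-negative integer $n$ with probability $(1-a)a^n$ (with $0^0=1$), and then choose $g$ uniformly at random from the finite symplectic group $Sp(2n,q)$, acting naturally on $\mathbb F_q^{2n}$ ($Sp(0,q)$ is the trivial group acting on the zero space). Let $Z=|\{v\in\mathbb F_q^{2n}: gv=v\}|$ be the number of fixed vectors of $g$. For real $x$ and $0<p<1$ write $(x;p)_k=\prod_{i=0}^{k-1}(1-xp^i)$ and $(x;p)_\infty=\prod_{i\ge 0}(1-xp^i)$, and let $$w_{AC}(p^{-k};b;p)=(bp;p)_\infty\,\frac{p^{k^2}b^k}{(p;p)_k\,(bp;p)_k},\qquad k=0,1,2,\dots,$$ be the Al-Salam–Carlitz weight. Then for every integer $k\ge 0$, $$P\left(Z\in\{q^{2k},\,q^{2k+1}\}\right)=w_{AC}\left(q^{2k};\tfrac aq;\tfrac1{q^2}\right),$$ that is, the weight with $p=1/q^2$ and $b=a/q$, and these weights sum to $1$ over $k\ge 0$, so they form a probability measure. -/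

import Mathlib

open scoped ENNReal

/-- The finite `p`-shifted factorial `(x; p)_k = ∏_{0 ≤ i < k} (1 - x p^i)`. -/
noncomputable def qPoch (x p : ℝ) (k : ℕ) : ℝ :=
  ∏ i ∈ Finset.range k, (1 - x * p ^ i)

/-- The infinite `p`-shifted factorial `(x; p)_∞ = ∏_{i ≥ 0} (1 - x p^i)`. -/
noncomputable def qPochInf (x p : ℝ) : ℝ :=
  ∏' i : ℕ, (1 - x * p ^ i)

/-- The infinite product defining `(x; p)_∞` converges for `0 ≤ p < 1`. -/
theorem multipliable_qPochInf (x : ℝ) {p : ℝ} (hp0 : 0 ≤ p) (hp1 : p < 1) :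
    Multipliable (fun i : ℕ => 1 - x * p ^ i) := by
  have h : Summable (fun i : ℕ => ‖-(x * p ^ i)‖) := by
    have := ((summable_geometric_of_lt_one hp0 hp1).mul_left x).norm
    simpa only [norm_neg] using this
  simpa only [sub_eq_add_neg] using multipliable_one_add_of_summable h

/-- The Al-Salam–Carlitz weight
`w_AC(p^{-k}; b; p) = (bp; p)_∞ p^{k²} b^k / ((p; p)_k (bp; p)_k)`,
the mass at the point `p^{-k}`. -/
noncomputable def alSalamCarlitzWeight (b p : ℝ) (k : ℕ) : ℝ :=
  qPochInf (b * p) p * (p ^ (k ^ 2) * b ^ k / (qPoch p p k * qPoch (b * p) p k))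

/-- The geometric distribution on `ℕ`, giving `n` the probability `(1 - a) a^n`. -/
noncomputable def geometricLaw (a : ℝ) (ha0 : 0 ≤ a) (ha1 : a < 1) : PMF ℕ :=
  ⟨fun n => ENNReal.ofReal ((1 - a) * a ^ n), by
    have h : HasSum (fun n : ℕ => (1 - a) * a ^ n) 1 := by
      have := (hasSum_geometric_of_lt_one ha0 ha1).mul_left (1 - a)
      rwa [mul_inv_cancel₀ (sub_ne_zero.mpr ha1.ne')] at this
    have h0 : ∀ n : ℕ, 0 ≤ (1 - a) * a ^ n := fun n =>
      mul_nonneg (sub_nonneg.mpr ha1.le) (pow_nonneg ha0 n)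
    have := ENNReal.ofReal_tsum_of_nonneg h0 h.summable
    rw [h.tsum_eq, ENNReal.ofReal_one] at this
    rw [this]
    exact ENNReal.summable.hasSum⟩

/-- `Sp(2n, F)`: the `2n × 2n` matrices over `F` preserving the standard alternating form. -/
abbrev Sp (n : ℕ) (F : Type*) [Field F] : Type _ :=
  Matrix.symplecticGroup (Fin n) F

noncomputable instance Sp.fintype (n : ℕ) (F : Type*) [Field F] [Finite F] :
    Fintype (Sp n F) :=
  Fintype.ofFinite _

/-- The number of fixed vectors of `g ∈ Sp(2n, F)` in its natural action on `F^{2n}`. -/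
noncomputable def fixedVectorCount {n : ℕ} {F : Type*} [Field F] (g : Sp n F) : ℕ :=
  Nat.card {v : Fin n ⊕ Fin n → F // (g : Matrix (Fin n ⊕ Fin n) (Fin n ⊕ Fin n) F).mulVec v = v}

/-- The law of the number of fixed vectors of a random element of a random `Sp(2n, F)`:
first `n` is chosen with probability `(1 - a) a^n`, then `g` is uniform in `Sp(2n, F)`. -/
noncomputable def fixedVectorLaw (F : Type*) [Field F] [Finite F]
    (a : ℝ) (ha0 : 0 ≤ a) (ha1 : a < 1) : PMF ℕ :=
  (geometricLaw a ha0 ha1).bind fun n =>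
    (PMF.uniformOfFintype (Sp n F)).map fixedVectorCount

/-! An independent `m`-tuple is fixed by `g` exactly when it lies in the fixed space, so `g` fixes
`tupleCount q m d` of them, where `d` is the dimension of that space. By Burnside's lemma the
average of this number over Sp(2n, q) is the number of orbits on independent `m`-tuples. By Witt's
theorem an orbit is the same thing as a Gram matrix, and an alternating `m × m` matrix `B` occurs as
one exactly when `m + dim ker B ≤ 2n` (`card_orbits_indepTuple`). The system of these moments is
triangular, so they determine the law of `d` (`eq_zero_of_sum_mul_tupleCount_eq_zero`).

As `m + dim ker B` is always even, passing from `n - 1` to `n` adds exactly `altCount F m n` orbits.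
The law of `d` for `n` is therefore a sum of increments whose `m`-th moments are these counts. The
closed form `fixCoeff` of the increments is verified, not derived: its moments obey the recurrence
in `m` that bordering a matrix by one row and column gives for `altCount`
(`sum_fixCoeff_mul_tupleCount`, `altCount_succ_succ`).

Mixing over a geometric `n` turns partial sums of increments into their generating function in `a`.
For the pair `d = 2k, 2k + 1` this is Euler's series for an infinite product, and the
Al-Salam–Carlitz weight results (`hasSum_evenCoeff`). -/

/-! ### Counting independent tuples -/

/-- The number of linearly independent `m`-tuples in a `d`-dimensional space over a field with
`q` elements. -/
noncomputable def tupleCount (q : ℝ) (m d : ℕ) : ℝ :=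
  ∏ i ∈ Finset.range m, (q ^ d - q ^ i)

theorem tupleCount_succ (q : ℝ) (m d : ℕ) :
    tupleCount q (m + 1) d = tupleCount q m d * (q ^ d - q ^ m) :=
  Finset.prod_range_succ _ _

theorem tupleCount_eq_zero (q : ℝ) {m d : ℕ} (h : d < m) : tupleCount q m d = 0 :=
  Finset.prod_eq_zero (Finset.mem_range.2 h) (sub_self _)

theorem tupleCount_self_ne_zero {q : ℝ} (hq : 1 < q) (d : ℕ) : tupleCount q d d ≠ 0 :=
  Finset.prod_ne_zero_iff.2 fun _ hi =>
    sub_ne_zero.2 (pow_lt_pow_right₀ hq (Finset.mem_range.1 hi)).ne'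

theorem tupleCount_succ_succ (q : ℝ) (m d : ℕ) :
    tupleCount q (m + 1) (d + 1) = (q ^ (d + 1) - 1) * q ^ m * tupleCount q m d := by
  unfold tupleCount
  rw [Finset.prod_range_succ', pow_zero, mul_comm, mul_assoc]
  congr 1
  have h : q ^ m = ∏ _i ∈ Finset.range m, q := by simp
  rw [h, ← Finset.prod_mul_distrib]
  exact Finset.prod_congr rfl fun i _ => by ring

/-- Summation by parts based on `tupleCount_succ_succ`. The lower boundary term vanishes because the
zero space has no independent `(m + 1)`-tuple, the upper one because `f N = 0`. -/
theorem sum_shift_tupleCount (q : ℝ) (m N : ℕ) (f : ℕ → ℝ) (hf : f N = 0) :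
    ∑ d ∈ Finset.range N, (q ^ (d + 1) - 1) * f (d + 1) * (q ^ m * tupleCount q m d) =
      ∑ d ∈ Finset.range N, f d * tupleCount q (m + 1) d := by
  have h := Finset.sum_range_succ' (fun d => f d * tupleCount q (m + 1) d) N
  rw [Finset.sum_range_succ, hf, tupleCount_eq_zero q (Nat.succ_pos m), zero_mul, mul_zero,
    add_zero, add_zero] at h
  rw [h]
  exact Finset.sum_congr rfl fun d _ => by rw [tupleCount_succ_succ]; ring

/-! ### Closed form and recurrence of the increments -/

/-- The product `∏_{1 ≤ j ≤ n} (q^{2j} - 1)`. -/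
noncomputable def evenProd (q : ℝ) (n : ℕ) : ℝ :=
  ∏ j ∈ Finset.range n, (q ^ (2 * (j + 1)) - 1)

theorem evenProd_succ (q : ℝ) (n : ℕ) :
    evenProd q (n + 1) = evenProd q n * (q ^ (2 * (n + 1)) - 1) :=
  Finset.prod_range_succ _ _

theorem pow_sub_one_ne_zero {q : ℝ} (hq : 1 < q) {n : ℕ} (hn : n ≠ 0) : q ^ n - 1 ≠ 0 :=
  sub_ne_zero.2 (one_lt_pow₀ hq hn).ne'

theorem evenProd_ne_zero {q : ℝ} (hq : 1 < q) (n : ℕ) : evenProd q n ≠ 0 :=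
  Finset.prod_ne_zero_iff.2 fun _ _ => pow_sub_one_ne_zero hq (by omega)

/-- The increment, from `Sp(2(k+i)-2, q)` to `Sp(2(k+i), q)`, of the probability that the fixed
space has dimension `2k`. -/
noncomputable def evenCoeff (q : ℝ) (k i : ℕ) : ℝ :=
  (-1) ^ i * q ^ i / (q ^ (2 * i * k) * q ^ (k ^ 2) * evenProd q i * evenProd q k)

theorem evenCoeff_succ_left {q : ℝ} (hq : 1 < q) (k i : ℕ) :
    (q ^ (2 * k + 2) - 1) * evenCoeff q (k + 1) i =
      -(1 - 1 / q ^ (2 * (i + 1))) * evenCoeff q k (i + 1) := by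
  have h0 : q ≠ 0 := by positivity
  have hk := evenProd_ne_zero hq k
  have hi := evenProd_ne_zero hq i
  have h1 := pow_sub_one_ne_zero hq (n := 2 * (k + 1)) (by omega)
  have h2 := pow_sub_one_ne_zero hq (n := 2 * (i + 1)) (by omega)
  unfold evenCoeff
  rw [evenProd_succ, evenProd_succ, show 2 * k + 2 = 2 * (k + 1) by ring]
  have h3 : 1 - 1 / q ^ (2 * (i + 1)) = (q ^ (2 * (i + 1)) - 1) / q ^ (2 * (i + 1)) := by
    field_simp
  rw [h3]
  generalize hu : q ^ (2 * (k + 1)) - 1 = u at *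
  generalize hv : q ^ (2 * (i + 1)) - 1 = v at *
  field_simp
  ring

theorem evenCoeff_succ_right {q : ℝ} (hq : 1 < q) (k i : ℕ) :
    (q ^ (2 * (i + 1)) - 1) * q ^ (2 * k) * evenCoeff q k (i + 1) = -q * evenCoeff q k i := by
  have h0 : q ≠ 0 := by positivity
  have hk := evenProd_ne_zero hq k
  have hi := evenProd_ne_zero hq i
  have h2 := pow_sub_one_ne_zero hq (n := 2 * (i + 1)) (by omega)
  unfold evenCoeff
  rw [evenProd_succ]
  generalize hv : q ^ (2 * (i + 1)) - 1 = v at *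
  field_simp
  ring

/-- The increment, from `Sp(2n-2, q)` to `Sp(2n, q)`, of the probability that the fixed space has
dimension `d`. -/
noncomputable def fixCoeff (q : ℝ) (n d : ℕ) : ℝ :=
  if d / 2 ≤ n then
    (if d % 2 = 0 then 1 else -(1 - 1 / q ^ (2 * (n - d / 2)))) * evenCoeff q (d / 2) (n - d / 2)
  else 0

theorem fixCoeff_even (q : ℝ) (k i : ℕ) : fixCoeff q (k + i) (2 * k) = evenCoeff q k i := by
  simp [fixCoeff]

theorem fixCoeff_odd (q : ℝ) (k i : ℕ) :
    fixCoeff q (k + i) (2 * k + 1) = -(1 - 1 / q ^ (2 * i)) * evenCoeff q k i := by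
  have h1 : (2 * k + 1) / 2 = k := by omega
  have h2 : (2 * k + 1) % 2 = 1 := by omega
  simp [fixCoeff, h1, h2]

theorem fixCoeff_eq_zero (q : ℝ) {n d : ℕ} (h : 2 * n < d) : fixCoeff q n d = 0 := by
  unfold fixCoeff
  split_ifs with h1 h2
  · omega
  -- Only `d = 2n + 1` remains, where the factor `1 - 1 / q ^ 0` is zero.
  · have : n - d / 2 = 0 := by omega
    simp [this]
  · rfl

/-- This is what makes `fixAux` vanish at odd dimensions, so that a single term survives on the
right of `fixCoeff_rec`. -/
theorem fixCoeff_even_succ {q : ℝ} (hq : 1 < q) (n k : ℕ) :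
    (q ^ (2 * k + 2) - 1) * fixCoeff q n (2 * k + 2) = fixCoeff q n (2 * k + 1) := by
  rcases Nat.lt_or_ge k n with h | h
  · obtain ⟨i, rfl⟩ : ∃ i, n = k + 1 + i := ⟨n - (k + 1), by omega⟩
    rw [show 2 * k + 2 = 2 * (k + 1) by ring, fixCoeff_even, show k + 1 + i = k + (i + 1) by ring,
      fixCoeff_odd, ← evenCoeff_succ_left hq]
    ring
  · rw [fixCoeff_eq_zero q (by omega), fixCoeff_eq_zero q (by omega), mul_zero]

/-- The combination of consecutive coefficients in the recurrence in `n`. -/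
noncomputable def fixAux (q : ℝ) (n d : ℕ) : ℝ :=
  (fixCoeff q n d - (q ^ (d + 1) - 1) * fixCoeff q n (d + 1)) / q ^ d

theorem fixAux_odd {q : ℝ} (hq : 1 < q) (n k : ℕ) : fixAux q n (2 * k + 1) = 0 := by
  rw [fixAux, show 2 * k + 1 + 1 = 2 * k + 2 by ring, fixCoeff_even_succ hq, sub_self, zero_div]

theorem fixAux_eq_zero (q : ℝ) {n d : ℕ} (h : 2 * n < d) : fixAux q n d = 0 := by
  rw [fixAux, fixCoeff_eq_zero q h, fixCoeff_eq_zero q (by omega)]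
  simp

theorem fixAux_zero_even (q : ℝ) (k : ℕ) :
    fixAux q k (2 * k) = evenCoeff q k 0 / q ^ (2 * k) := by
  rw [fixAux, fixCoeff_eq_zero q (d := 2 * k + 1) (by omega)]
  have := fixCoeff_even q k 0
  rw [add_zero] at this
  rw [this]
  ring

theorem fixAux_even {q : ℝ} (hq : 1 < q) (k i : ℕ) :
    fixAux q (k + (i + 1)) (2 * k) =
      evenCoeff q k (i + 1) / q ^ (2 * (k + (i + 1))) -
        evenCoeff q k i / q ^ (2 * (k + i)) := by
  have h0 : q ≠ 0 := by positivity
  have h2 := pow_sub_one_ne_zero hq (n := 2 * (i + 1)) (by omega)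
  have h := evenCoeff_succ_right hq k i
  have h' : evenCoeff q k i =
      -(q ^ (2 * (i + 1)) - 1) * q ^ (2 * k) * evenCoeff q k (i + 1) / q := by
    field_simp
    linarith
  rw [fixAux, fixCoeff_even, fixCoeff_odd, h']
  field_simp
  ring

theorem fixCoeff_rec_zero (q : ℝ) (d : ℕ) :
    fixCoeff q 0 d = fixAux q 0 d + (q ^ (d + 1) - 1) * fixAux q 0 (d + 1) := by
  rw [fixAux_eq_zero q (n := 0) (d := d + 1) (by omega), mul_zero, add_zero]
  rcases Nat.eq_zero_or_pos d with rfl | h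
  · have := fixAux_zero_even q 0
    have h2 := fixCoeff_even q 0 0
    simp at this h2
    rw [this, h2]
  · rw [fixCoeff_eq_zero q (by omega), fixAux_eq_zero q (by omega)]

/-- Paired with `q ^ m * tupleCount q m d` and summed over `d`, this becomes the recurrence of
`altCount` in `m`. For even `d` the surviving term is the telescoping difference of `fixAux_even`;
for odd `d` it is that difference at `d + 1`, carried back by `evenCoeff_succ_left`. -/
theorem fixCoeff_rec {q : ℝ} (hq : 1 < q) (n d : ℕ) :
    fixCoeff q (n + 1) d / q ^ (2 * (n + 1)) - fixCoeff q n d / q ^ (2 * n) =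
      fixAux q (n + 1) d + (q ^ (d + 1) - 1) * fixAux q (n + 1) (d + 1) := by
  obtain ⟨k, rfl | rfl⟩ : ∃ k, d = 2 * k ∨ d = 2 * k + 1 := ⟨d / 2, by omega⟩
  · rw [fixAux_odd hq, mul_zero, add_zero]
    rcases lt_trichotomy k (n + 1) with h | rfl | h
    · obtain ⟨i, rfl⟩ : ∃ i, n = k + i := ⟨n - k, by omega⟩
      rw [show k + i + 1 = k + (i + 1) by ring, fixAux_even hq, fixCoeff_even, fixCoeff_even]
    · have := fixCoeff_even q (n + 1) 0
      rw [add_zero] at this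
      rw [fixAux_zero_even q, this, fixCoeff_eq_zero q (by omega)]
      ring
    · rw [fixCoeff_eq_zero q (by omega), fixCoeff_eq_zero q (by omega), fixAux_eq_zero q (by omega)]
      ring
  · rw [fixAux_odd hq, zero_add, show 2 * k + 1 + 1 = 2 * (k + 1) by ring]
    have h0 : q ≠ 0 := by positivity
    rcases lt_trichotomy k n with h | rfl | h
    · obtain ⟨i, rfl⟩ : ∃ i, n = k + (i + 1) := ⟨n - (k + 1), by omega⟩
      have e1 := evenCoeff_succ_left hq k (i + 1)
      have e2 := evenCoeff_succ_left hq k i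
      rw [show k + (i + 1) + 1 = k + 1 + (i + 1) by ring, fixAux_even hq,
        fixCoeff_odd, show k + 1 + (i + 1) = k + (i + 1 + 1) by ring, fixCoeff_odd, ← e1, ← e2,
        show k + 1 + i = k + (i + 1) by ring]
      ring
    · rw [fixAux_zero_even q, fixCoeff_odd, ← evenCoeff_succ_left hq, fixCoeff_eq_zero q (by omega)]
      ring
    · rw [fixCoeff_eq_zero q (by omega), fixCoeff_eq_zero q (by omega), fixAux_eq_zero q (by omega)]
      ring

/-! ### Total mass and factorial moments of the increments -/

theorem sum_range_two_mul (f : ℕ → ℝ) (N : ℕ) :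
    ∑ d ∈ Finset.range (2 * N), f d = ∑ k ∈ Finset.range N, (f (2 * k) + f (2 * k + 1)) := by
  induction N with
  | zero => simp
  | succ N ih =>
    rw [show 2 * (N + 1) = 2 * N + 1 + 1 by ring, Finset.sum_range_succ, Finset.sum_range_succ, ih,
      Finset.sum_range_succ]
    ring

/-- The alternating sum of the `q²`-binomial coefficients, as a telescoping partial sum. -/
theorem sum_range_alternating {q : ℝ} (hq : 1 < q) (j r : ℕ) :
    ∑ i ∈ Finset.range (j + 1),
        (-1) ^ i * q ^ (i * (i - 1)) / (evenProd q i * evenProd q (j + r + 1 - i)) =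
      (-1) ^ j * q ^ (j * (j + 1)) /
        (evenProd q j * evenProd q r * (q ^ (2 * (j + r + 1)) - 1)) := by
  induction j generalizing r with
  | zero =>
    rw [Finset.sum_range_one, Nat.sub_zero, zero_add, evenProd_succ]
    simp [evenProd]
  | succ j ih =>
    have h := ih (r + 1)
    rw [show j + (r + 1) + 1 = j + 1 + r + 1 by ring] at h
    rw [Finset.sum_range_succ, h, show j + 1 + r + 1 - (j + 1) = r + 1 by omega, evenProd_succ,
      evenProd_succ]
    have h1 := evenProd_ne_zero hq j
    have h2 := evenProd_ne_zero hq r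
    have h3 := pow_sub_one_ne_zero hq (n := 2 * (j + 1)) (by omega)
    have h4 := pow_sub_one_ne_zero hq (n := 2 * (r + 1)) (by omega)
    have h5 := pow_sub_one_ne_zero hq (n := 2 * (j + 1 + r + 1)) (by omega)
    rw [Nat.add_sub_cancel, show (j + 1) * j = j * (j + 1) by ring,
      show q ^ ((j + 1) * (j + 1 + 1)) = q ^ (j * (j + 1)) * q ^ (2 * (j + 1)) by
        rw [← pow_add]; congr 1; ring]
    have e : q ^ (2 * (j + 1 + r + 1)) = q ^ (2 * (j + 1)) * q ^ (2 * (r + 1)) := by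
      rw [← pow_add]; congr 1; ring
    rw [e] at h5 ⊢
    generalize q ^ (2 * (j + 1)) = u at *
    generalize q ^ (2 * (r + 1)) = v at *
    rw [div_add_div _ _ (by simp [*]) (by simp [*]), div_eq_div_iff (by simp [*]) (by simp [*])]
    ring

theorem evenCoeff_pair (q : ℝ) (k i : ℕ) :
    evenCoeff q k i + -(1 - 1 / q ^ (2 * i)) * evenCoeff q k i = evenCoeff q k i / q ^ (2 * i) := by
  ring

/-- Differences of probability laws have total mass zero, except the first, which is the law for the
trivial group. Algebraically, adding the two dimensions of each pair leaves an alternating sum of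
`q²`-binomial coefficients. -/
theorem sum_fixCoeff {q : ℝ} (hq : 1 < q) (n : ℕ) :
    ∑ d ∈ Finset.range (2 * (n + 1)), fixCoeff q n d = if n = 0 then 1 else 0 := by
  have h0 : q ≠ 0 := by positivity
  rw [sum_range_two_mul, ← Finset.sum_range_reflect]
  have key : ∀ i ∈ Finset.range (n + 1),
      fixCoeff q n (2 * (n + 1 - 1 - i)) + fixCoeff q n (2 * (n + 1 - 1 - i) + 1) =
        (-1) ^ i * q ^ (i * (i - 1)) / (evenProd q i * evenProd q (n - i)) / q ^ (n ^ 2) := by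
    intro i hi
    obtain ⟨k, rfl⟩ : ∃ k, n = k + i := ⟨n - i, by have := Finset.mem_range.1 hi; omega⟩
    rw [show k + i + 1 - 1 - i = k by omega, show k + i - i = k by omega, fixCoeff_even,
      fixCoeff_odd, evenCoeff_pair, evenCoeff]
    have h1 := evenProd_ne_zero hq i
    have h2 := evenProd_ne_zero hq k
    have e : q ^ ((k + i) ^ 2) * q ^ i =
        q ^ (2 * i * k) * q ^ (k ^ 2) * q ^ (2 * i) * q ^ (i * (i - 1)) := by
      rw [← pow_add, ← pow_add, ← pow_add, ← pow_add]
      congr 1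
      rcases i with _ | i
      · simp
      · simp only [Nat.add_sub_cancel]; ring
    field_simp
    rw [mul_comm, e]
  rw [Finset.sum_congr rfl key, ← Finset.sum_div]
  rcases n with _ | n
  · simp [evenProd]
  -- The partial sum without the last term is exactly the negative of that term.
  · have h := sum_range_alternating hq n 0
    rw [add_zero] at h
    rw [Finset.sum_range_succ, h]
    have h1 := evenProd_ne_zero hq n
    have h3 := pow_sub_one_ne_zero hq (n := 2 * (n + 1)) (by omega)
    simp only [Nat.add_sub_cancel, Nat.sub_self, evenProd_succ,
      show evenProd q 0 = 1 from Finset.prod_range_zero _]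
    rw [show (n + 1) * n = n * (n + 1) by ring]
    simp only [Nat.succ_ne_zero, if_false]
    rw [pow_succ (-1 : ℝ)]
    field_simp
    ring

theorem sum_fixCoeff_mul_eq (q : ℝ) (n N : ℕ) (hN : 2 * n + 1 ≤ N) (f : ℕ → ℝ) :
    ∑ d ∈ Finset.range N, fixCoeff q n d * f d =
      ∑ d ∈ Finset.range (2 * n + 1), fixCoeff q n d * f d := by
  symm
  apply Finset.sum_subset (Finset.range_mono hN)
  intro d _ hd
  rw [fixCoeff_eq_zero q (by simpa using hd), zero_mul]

/-- If `α m t` satisfies the recurrence of the number of alternating forms of given rank, then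
`α m n` is the `m`-th factorial moment of `fixCoeff q n`. -/
theorem sum_fixCoeff_mul_tupleCount {q : ℝ} (hq : 1 < q) (α : ℕ → ℕ → ℝ)
    (h0 : ∀ t, α 0 t = if t = 0 then 1 else 0)
    (hz : ∀ m, α (m + 1) 0 = (q ^ m - q ^ (2 * m)) * α m 0)
    (hs : ∀ m t, q ^ (2 * (t + 1)) * α (m + 1) (t + 1) =
      q ^ (2 * m + 2) * α m t + (q ^ (m + 2 * (t + 1)) - q ^ (2 * m)) * α m (t + 1))
    (m n N : ℕ) (hN : 2 * n + 1 ≤ N) :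
    ∑ d ∈ Finset.range N, fixCoeff q n d * tupleCount q m d = α m n := by
  have hq0 : q ≠ 0 := by positivity
  have main : ∀ m n N, 2 * n + 1 ≤ N →
      ∑ d ∈ Finset.range N,
        (fixAux q n d + (q ^ (d + 1) - 1) * fixAux q n (d + 1)) * (q ^ m * tupleCount q m d) =
      ∑ d ∈ Finset.range N, fixCoeff q n d * tupleCount q m d -
        (∑ d ∈ Finset.range N, fixCoeff q n d * tupleCount q (m + 1) d) / q ^ m := by
    intro m n N hN
    simp only [add_mul, Finset.sum_add_distrib]
    -- After the shift, `fixAux q n d` has the coefficient `q ^ m * tupleCount q m d + tupleCount q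
    -- (m + 1) d = q ^ d * tupleCount q m d`, which cancels its denominator. A second shift treats
    -- the term in `fixCoeff q n (d + 1)`.
    rw [sum_shift_tupleCount q m N (fixAux q n) (fixAux_eq_zero q (by omega)),
      ← sum_shift_tupleCount q m N (fixCoeff q n) (fixCoeff_eq_zero q (by omega)),
      Finset.sum_div, ← Finset.sum_add_distrib, ← Finset.sum_sub_distrib]
    refine Finset.sum_congr rfl fun d _ => ?_
    rw [tupleCount_succ, fixAux]
    field_simp
    ring
  induction m generalizing n N with
  | zero =>
    have := sum_fixCoeff hq n
    simp only [tupleCount, Finset.range_zero, Finset.prod_empty, h0]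
    rw [sum_fixCoeff_mul_eq q n N hN, ← this]
    have h := sum_fixCoeff_mul_eq q n (2 * (n + 1)) (by omega) (fun _ => 1)
    simpa using h.symm
  | succ m ih =>
    have h := main m n N hN
    rw [ih n N hN] at h
    rcases n with _ | n
    · simp only [← fixCoeff_rec_zero q] at h
      have h2 := ih 0 N hN
      have h3 : ∑ d ∈ Finset.range N, fixCoeff q 0 d * (q ^ m * tupleCount q m d) =
          q ^ m * α m 0 := by
        rw [← h2, Finset.mul_sum]
        exact Finset.sum_congr rfl fun d _ => by ring
      rw [h3] at h
      rw [hz]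
      field_simp at h
      rw [show q ^ (2 * m) = q ^ m * q ^ m by ring]
      linear_combination h
    · simp only [← fixCoeff_rec hq] at h
      have h2 := ih (n + 1) N hN
      have h4 := ih n N (by omega)
      have h3 : ∑ d ∈ Finset.range N,
          (fixCoeff q (n + 1) d / q ^ (2 * (n + 1)) - fixCoeff q n d / q ^ (2 * n)) *
            (q ^ m * tupleCount q m d) =
          q ^ m * (α m (n + 1) / q ^ (2 * (n + 1)) - α m n / q ^ (2 * n)) := by
        rw [← h2, ← h4, Finset.sum_div, Finset.sum_div, ← Finset.sum_sub_distrib, Finset.mul_sum]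
        exact Finset.sum_congr rfl fun d _ => by ring
      rw [h3] at h
      have h5 := hs m n
      have hp : q ^ (2 * (n + 1)) ≠ 0 := by positivity
      apply mul_left_cancel₀ hp
      rw [h5]
      have e1 : q ^ (2 * (n + 1)) = q ^ (2 * n) * q ^ 2 := by ring
      have e2 : q ^ (m + 2 * (n + 1)) = q ^ m * (q ^ (2 * n) * q ^ 2) := by ring
      have e3 : q ^ (2 * m) = q ^ m * q ^ m := by ring
      have e4 : q ^ (2 * m + 2) = q ^ m * q ^ m * q ^ 2 := by ring
      rw [e1] at h
      rw [e1, e2, e3, e4]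
      field_simp at h
      linear_combination h

/-! ### Euler's expansion and the geometric mixture -/

theorem qPoch_succ (x p : ℝ) (k : ℕ) : qPoch x p (k + 1) = qPoch x p k * (1 - x * p ^ k) :=
  Finset.prod_range_succ _ _

theorem qPoch_self_ne_zero {p : ℝ} (hp0 : 0 ≤ p) (hp1 : p < 1) (k : ℕ) : qPoch p p k ≠ 0 := by
  refine Finset.prod_ne_zero_iff.2 fun i _ => ?_
  rw [← pow_succ']
  exact (sub_pos.2 (pow_lt_one₀ hp0 hp1 i.succ_ne_zero)).ne'

/-- The `i`-th coefficient of Euler's expansion of `(x; p)_∞`. -/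
noncomputable def eulerCoeff (p : ℝ) (i : ℕ) : ℝ :=
  (-1) ^ i * p ^ (i * (i - 1) / 2) / qPoch p p i

theorem eulerCoeff_zero (p : ℝ) : eulerCoeff p 0 = 1 := by simp [eulerCoeff, qPoch]

theorem eulerCoeff_succ {p : ℝ} (hp0 : 0 ≤ p) (hp1 : p < 1) (i : ℕ) :
    eulerCoeff p (i + 1) * (1 - p ^ (i + 1)) = -p ^ i * eulerCoeff p i := by
  have h1 := qPoch_self_ne_zero hp0 hp1 i
  have h2 : 1 - p * p ^ i ≠ 0 := by
    rw [← pow_succ']; exact (sub_pos.2 (pow_lt_one₀ hp0 hp1 i.succ_ne_zero)).ne'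
  have e : (i + 1) * (i + 1 - 1) / 2 = i + i * (i - 1) / 2 := by
    rw [← Finset.sum_range_id_mul_two, ← Finset.sum_range_id_mul_two, Finset.sum_range_succ]
    omega
  rw [eulerCoeff, eulerCoeff, qPoch_succ, e, pow_add p i, pow_succ' p i]
  generalize hv : 1 - p * p ^ i = v at *
  field_simp
  ring

theorem summable_eulerCoeff {p : ℝ} (hp0 : 0 ≤ p) (hp1 : p < 1) (x : ℝ) :
    Summable fun i => ‖eulerCoeff p i * x ^ i‖ := by
  have ht : Filter.Tendsto (fun i : ℕ => p ^ i / (1 - p) * |x|) Filter.atTop (nhds 0) := by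
    have := ((tendsto_pow_atTop_nhds_zero_of_lt_one hp0 hp1).div_const (1 - p)).mul_const |x|
    simpa using this
  suffices h : Summable fun i => eulerCoeff p i * x ^ i from h.norm
  refine summable_of_ratio_norm_eventually_le (r := 1 / 2) (by norm_num) ?_
  filter_upwards [ht.eventually_le_const (show (0 : ℝ) < 1 / 2 by norm_num)] with i hi
  have hpos : 0 < 1 - p ^ (i + 1) := sub_pos.2 (pow_lt_one₀ hp0 hp1 i.succ_ne_zero)
  have h : eulerCoeff p (i + 1) = -p ^ i * eulerCoeff p i / (1 - p ^ (i + 1)) := by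
    rw [← eulerCoeff_succ hp0 hp1, mul_div_cancel_right₀ _ hpos.ne']
  have hle : p ^ i / (1 - p ^ (i + 1)) ≤ p ^ i / (1 - p) := by
    apply div_le_div_of_nonneg_left (by positivity) (by linarith)
    have : p ^ (i + 1) ≤ p := pow_le_of_le_one hp0 hp1.le i.succ_ne_zero
    linarith
  rw [h, Real.norm_eq_abs, Real.norm_eq_abs, pow_succ x, abs_mul, abs_div, abs_mul, abs_neg,
    abs_mul, abs_mul _ (x ^ i), abs_of_pos hpos, abs_of_nonneg (pow_nonneg hp0 i)]
  calc p ^ i * |eulerCoeff p i| / (1 - p ^ (i + 1)) * (|x ^ i| * |x|)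
      = p ^ i / (1 - p ^ (i + 1)) * |x| * (|eulerCoeff p i| * |x ^ i|) := by ring
    _ ≤ p ^ i / (1 - p) * |x| * (|eulerCoeff p i| * |x ^ i|) := by gcongr
    _ ≤ 1 / 2 * (|eulerCoeff p i| * |x ^ i|) := by gcongr

/-- The sum of Euler's series. -/
noncomputable def eulerSum (p x : ℝ) : ℝ := ∑' i, eulerCoeff p i * x ^ i

/-- In `eulerSum p x - eulerSum p (p * x)` the coefficient of `x ^ i` gains a factor `1 - p ^ i`,
and `eulerCoeff_succ` identifies the result with `-x * eulerSum p (p * x)`. -/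
theorem eulerSum_step {p : ℝ} (hp0 : 0 ≤ p) (hp1 : p < 1) (x : ℝ) :
    eulerSum p x = (1 - x) * eulerSum p (p * x) := by
  have s1 := (summable_eulerCoeff hp0 hp1 x).of_norm
  have s2 := (summable_eulerCoeff hp0 hp1 (p * x)).of_norm
  have h : eulerSum p x - eulerSum p (p * x) = -x * eulerSum p (p * x) := by
    unfold eulerSum
    rw [← s1.tsum_sub s2, (s1.sub s2).tsum_eq_zero_add, ← tsum_mul_left]
    simp only [pow_zero, sub_self, zero_add]
    refine tsum_congr fun i => ?_
    have := eulerCoeff_succ hp0 hp1 i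
    rw [mul_pow p x i, mul_pow p x (i + 1), pow_succ x]
    linear_combination x ^ i * x * this
  linarith

theorem eulerSum_eq_qPoch_mul {p : ℝ} (hp0 : 0 ≤ p) (hp1 : p < 1) (x : ℝ) (n : ℕ) :
    eulerSum p x = qPoch x p n * eulerSum p (x * p ^ n) := by
  induction n with
  | zero => simp [qPoch]
  | succ n ih =>
    rw [ih, eulerSum_step hp0 hp1, qPoch_succ, mul_assoc,
      show p * (x * p ^ n) = x * p ^ (n + 1) by ring]

theorem abs_eulerSum_sub_one_le {p : ℝ} (hp0 : 0 ≤ p) (hp1 : p < 1) {x : ℝ} (hx : |x| ≤ 1) :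
    |eulerSum p x - 1| ≤ |x| * ∑' i, |eulerCoeff p (i + 1)| := by
  have s1 := (summable_eulerCoeff hp0 hp1 x).of_norm
  have s2 : Summable fun i => |eulerCoeff p (i + 1)| := by
    have := summable_eulerCoeff hp0 hp1 1
    simp only [one_pow, mul_one, Real.norm_eq_abs] at this
    exact (summable_nat_add_iff 1).2 this
  have h : eulerSum p x - 1 = ∑' i, eulerCoeff p (i + 1) * x ^ (i + 1) := by
    rw [eulerSum, s1.tsum_eq_zero_add, eulerCoeff_zero]
    ring
  rw [h, ← tsum_mul_left, ← Real.norm_eq_abs]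
  refine tsum_of_norm_bounded (s2.mul_left |x|).hasSum fun i => ?_
  rw [Real.norm_eq_abs, abs_mul, abs_pow, pow_succ]
  have : |x| ^ i ≤ 1 := pow_le_one₀ (abs_nonneg x) hx
  calc |eulerCoeff p (i + 1)| * (|x| ^ i * |x|)
      ≤ |eulerCoeff p (i + 1)| * (1 * |x|) := by gcongr
    _ = _ := by ring

/-- Iterating the functional equation splits off the first `n` factors of the product; the rest,
`eulerSum p (x * p ^ n)`, tends to 1 by continuity at 0. -/
theorem eulerSum_eq_qPochInf {p : ℝ} (hp0 : 0 ≤ p) (hp1 : p < 1) (x : ℝ) :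
    eulerSum p x = qPochInf x p := by
  have hx : Filter.Tendsto (fun n : ℕ => x * p ^ n) Filter.atTop (nhds 0) := by
    simpa using (tendsto_pow_atTop_nhds_zero_of_lt_one hp0 hp1).const_mul x
  have h1 : Filter.Tendsto (fun n : ℕ => eulerSum p (x * p ^ n)) Filter.atTop (nhds 1) := by
    rw [tendsto_iff_norm_sub_tendsto_zero]
    have hb : Filter.Tendsto (fun n : ℕ => |x * p ^ n| * ∑' i, |eulerCoeff p (i + 1)|)
        Filter.atTop (nhds 0) := by
      simpa using hx.abs.mul_const (∑' i, |eulerCoeff p (i + 1)|)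
    refine squeeze_zero' (Filter.Eventually.of_forall fun _ => norm_nonneg _) ?_ hb
    filter_upwards [hx.abs.eventually_le_const (show |(0 : ℝ)| < 1 by simp)] with n hn
    exact abs_eulerSum_sub_one_le hp0 hp1 hn
  have h2 := (multipliable_qPochInf x hp0 hp1).hasProd.tendsto_prod_nat
  have h3 := h2.mul h1
  rw [mul_one] at h3
  refine tendsto_nhds_unique (Filter.Tendsto.congr (fun n => ?_) tendsto_const_nhds) h3
  exact eulerSum_eq_qPoch_mul hp0 hp1 x n

theorem qPochInf_shift {p : ℝ} (hp0 : 0 ≤ p) (hp1 : p < 1) (x : ℝ) (k : ℕ) :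
    qPochInf x p = qPoch x p k * qPochInf (x * p ^ k) p := by
  rw [← eulerSum_eq_qPochInf hp0 hp1, ← eulerSum_eq_qPochInf hp0 hp1]
  exact eulerSum_eq_qPoch_mul hp0 hp1 x k

theorem qPoch_inv_sq {q : ℝ} (hq : 1 < q) (i : ℕ) :
    q ^ (i * (i + 1)) * qPoch (1 / q ^ 2) (1 / q ^ 2) i = evenProd q i := by
  have h0 : q ≠ 0 := by positivity
  induction i with
  | zero => simp [qPoch, evenProd]
  | succ i ih =>
    rw [qPoch_succ, evenProd_succ, ← ih]
    have e : q ^ ((i + 1) * (i + 1 + 1)) = q ^ (i * (i + 1)) * q ^ (2 * (i + 1)) := by ring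
    have e2 : q ^ (2 * (i + 1)) * (1 - 1 / q ^ 2 * (1 / q ^ 2) ^ i) = q ^ (2 * (i + 1)) - 1 := by
      rw [← pow_succ', div_pow, one_pow, ← pow_mul, mul_sub, mul_one_div_cancel (by positivity),
        mul_one]
    rw [e, ← e2]
    ring

/-- With `p = 1 / q ^ 2` and `b = a / q` the terms are a constant times those of Euler's series at
`b * p ^ (k + 1)`. Its sum is `(bp; p)_∞ / (bp; p)_k`, the denominator being nonzero since `b < 1`.
-/
theorem hasSum_evenCoeff {q : ℝ} (hq : 1 < q) {a : ℝ} (ha0 : 0 ≤ a) (ha1 : a < 1) (k : ℕ) :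
    HasSum (fun i => a ^ (k + i) * (evenCoeff q k i / q ^ (2 * i)))
      (alSalamCarlitzWeight (a / q) (1 / q ^ 2) k) ∧
    Summable (fun i => ‖a ^ (k + i) * (evenCoeff q k i / q ^ (2 * i))‖) := by
  have h0 : 0 < q := by positivity
  set p := 1 / q ^ 2 with hp
  have hp0 : 0 ≤ p := by positivity
  have hp1 : p < 1 := by
    rw [hp, div_lt_one (by positivity)]
    exact one_lt_pow₀ hq (by norm_num)
  have key : ∀ i, a ^ (k + i) * (evenCoeff q k i / q ^ (2 * i)) =
      a ^ k / (q ^ (k ^ 2) * evenProd q k) * (eulerCoeff p i * (a / q * p * p ^ k) ^ i) := by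
    intro i
    have e2 : 2 * (i * (i - 1) / 2) = i * (i - 1) :=
      Nat.mul_div_cancel' (Nat.even_mul_pred_self i).two_dvd
    have e : p ^ (i * (i - 1) / 2) = 1 / q ^ (i * (i - 1)) := by
      rw [hp, div_pow, one_pow, ← pow_mul, e2]
    have hi := evenProd_ne_zero hq i
    have hk := evenProd_ne_zero hq k
    have hqi := qPoch_inv_sq hq i
    have hq2 := qPoch_self_ne_zero hp0 hp1 i
    rw [evenCoeff, eulerCoeff, e, ← hqi, hp]
    rw [hp] at hq2
    have e3 : q ^ (i * (i + 1)) = q ^ (i * (i - 1)) * q ^ (2 * i) := by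
      rw [← pow_add]
      congr 1
      rcases i with _ | i
      · rfl
      · simp only [Nat.add_sub_cancel]; ring
    have e4 : (a / q * (1 / q ^ 2) * (1 / q ^ 2) ^ k) ^ i =
        a ^ i / (q ^ i * q ^ (2 * i) * q ^ (2 * i * k)) := by
      simp only [mul_pow, div_pow, one_pow, ← pow_mul]
      rw [show 2 * k * i = 2 * i * k by ring]
      field_simp
    have e5 : q ^ (2 * i) = q ^ i * q ^ i := by ring
    rw [e3, e4, e5, pow_add]
    field_simp
  simp only [key]
  have hs := summable_eulerCoeff hp0 hp1 (a / q * p * p ^ k)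
  refine ⟨?_, by simpa only [norm_mul] using (hs.mul_left _)⟩
  have h := hs.of_norm.hasSum.mul_left (a ^ k / (q ^ (k ^ 2) * evenProd q k))
  have hb : qPoch (a / q * p) p k ≠ 0 := by
    refine Finset.prod_ne_zero_iff.2 fun i _ => ?_
    have h1 : a / q < 1 := by rw [div_lt_one h0]; linarith
    have h2 : a / q * (p * p ^ i) ≤ a / q * 1 := by
      gcongr
      rw [← pow_succ']
      exact pow_le_one₀ hp0 hp1.le
    rw [mul_assoc]
    linarith
  suffices hw : alSalamCarlitzWeight (a / q) p k =
      a ^ k / (q ^ (k ^ 2) * evenProd q k) * eulerSum p (a / q * p * p ^ k) by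
    rw [hw]; exact h
  rw [eulerSum_eq_qPochInf hp0 hp1, alSalamCarlitzWeight, qPochInf_shift hp0 hp1 _ k,
    ← qPoch_inv_sq hq k, ← hp]
  have hk := qPoch_self_ne_zero hp0 hp1 k
  have e1 : p ^ (k ^ 2) = 1 / (q ^ (k ^ 2) * q ^ (k ^ 2)) := by
    rw [hp, div_pow, one_pow, ← pow_mul]; ring
  have e2 : q ^ (k * (k + 1)) = q ^ (k ^ 2) * q ^ k := by ring
  rw [e1, e2, div_pow a q]
  generalize qPochInf (a / q * p * p ^ k) p = Q
  generalize qPoch (a / q * p) p k = A at *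
  field_simp

/-- The Cauchy product of `∑ a ^ n * f n` with the geometric series, whose sum cancels `1 - a`. -/
theorem hasSum_mul_sum_range {a : ℝ} (ha0 : 0 ≤ a) (ha1 : a < 1) {f : ℕ → ℝ}
    (hf : Summable fun n => ‖a ^ n * f n‖) :
    HasSum (fun n => (1 - a) * a ^ n * ∑ t ∈ Finset.range (n + 1), f t) (∑' n, a ^ n * f n) := by
  have hg : Summable fun n : ℕ => ‖a ^ n‖ := (summable_geometric_of_lt_one ha0 ha1).norm
  have h := (summable_norm_sum_mul_range_of_summable_norm hf hg).of_norm.hasSum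
  rw [← tsum_mul_tsum_eq_tsum_sum_range_of_summable_norm hf hg,
    tsum_geometric_of_lt_one ha0 ha1] at h
  have h2 := h.mul_left (1 - a)
  rw [mul_comm (1 - a) (_ * _), mul_assoc, inv_mul_cancel₀ (sub_ne_zero.2 ha1.ne'), mul_one] at h2
  refine h2.congr_fun fun n => ?_
  rw [mul_assoc, Finset.mul_sum]
  congr 1
  refine Finset.sum_congr rfl fun t ht => ?_
  rw [show n = t + (n - t) by have := Finset.mem_range.1 ht; omega, pow_add]
  rw [show t + (n - t) - t = n - t by omega]
  ring

/-- The geometric mixture of the partial sums of `fixCoeff` over the dimensions `2k`, `2k + 1`. -/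
theorem hasSum_geometric_fixCoeff {q : ℝ} (hq : 1 < q) {a : ℝ} (ha0 : 0 ≤ a) (ha1 : a < 1)
    (k : ℕ) :
    HasSum (fun n => (1 - a) * a ^ n *
      ∑ t ∈ Finset.range (n + 1), (fixCoeff q t (2 * k) + fixCoeff q t (2 * k + 1)))
      (alSalamCarlitzWeight (a / q) (1 / q ^ 2) k) := by
  obtain ⟨h1, h2⟩ := hasSum_evenCoeff hq ha0 ha1 k
  set f : ℕ → ℝ := fun t => fixCoeff q t (2 * k) + fixCoeff q t (2 * k + 1) with hf
  have hlt : ∀ t < k, f t = 0 := fun t ht => by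
    simp only [hf]
    rw [fixCoeff_eq_zero q (by omega), fixCoeff_eq_zero q (by omega), add_zero]
  have hadd : ∀ i, f (i + k) = evenCoeff q k i / q ^ (2 * i) := fun i => by
    simp only [hf]
    rw [add_comm i k, fixCoeff_even, fixCoeff_odd, evenCoeff_pair]
  have e : ∀ i, a ^ (k + i) * (evenCoeff q k i / q ^ (2 * i)) = a ^ (i + k) * f (i + k) :=
    fun i => by rw [hadd, add_comm]
  simp only [e] at h1 h2
  have s1 : Summable fun n => ‖a ^ n * f n‖ := (summable_nat_add_iff k).1 h2
  have h3 := hasSum_mul_sum_range ha0 ha1 s1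
  rw [← s1.of_norm.sum_add_tsum_nat_add k, h1.tsum_eq,
    Finset.sum_eq_zero fun t ht => by rw [hlt t (Finset.mem_range.1 ht), mul_zero], zero_add] at h3
  exact h3

/-! ### Alternating matrices and bordering -/

/-- The alternating `m × m` matrices over `F`. -/
abbrev AltMatrix (F : Type*) [Field F] (m : ℕ) : Type _ :=
  {B : Matrix (Fin m) (Fin m) F // (∀ i, B i i = 0) ∧ ∀ i j, B j i = -B i j}

/-- The dimension of the kernel of a square matrix. -/
noncomputable def nullity {F : Type*} [Field F] {m : ℕ} (B : Matrix (Fin m) (Fin m) F) : ℕ :=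
  Module.finrank F (LinearMap.ker B.mulVecLin)

/-- The matrix `B` with an additional first column `(0, f)` and first row `(0, -f)`. -/
def borderMatrix {F : Type*} [Field F] {m : ℕ} (f : Fin m → F) (B : Matrix (Fin m) (Fin m) F) :
    Matrix (Fin (m + 1)) (Fin (m + 1)) F :=
  Matrix.of (Fin.cons (Fin.cons 0 (-f)) fun i => Fin.cons (f i) (B i))

section

variable {F : Type*} [Field F] {m : ℕ}

theorem nullity_le (B : Matrix (Fin m) (Fin m) F) : nullity B ≤ m := by
  simpa [nullity] using Submodule.finrank_le (LinearMap.ker B.mulVecLin)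

theorem finrank_range_add_nullity (B : Matrix (Fin m) (Fin m) F) :
    Module.finrank F (LinearMap.range B.mulVecLin) + nullity B = m := by
  simpa [nullity] using LinearMap.finrank_range_add_finrank_ker B.mulVecLin

theorem borderMatrix_mulVec (f : Fin m → F) (B : Matrix (Fin m) (Fin m) F) (c : F)
    (v : Fin m → F) :
    (borderMatrix f B).mulVec (Fin.cons c v) = Fin.cons (-(f ⬝ᵥ v)) (c • f + B.mulVec v) := by
  funext i
  refine Fin.cases ?_ (fun i => ?_) i
  · simp [borderMatrix, Matrix.mulVec, dotProduct, Fin.sum_univ_succ]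
  · simp [borderMatrix, Matrix.mulVec, dotProduct, Fin.sum_univ_succ, mul_comm]

theorem cons_mem_ker_borderMatrix (f : Fin m → F) (B : Matrix (Fin m) (Fin m) F) (c : F)
    (v : Fin m → F) :
    Fin.cons c v ∈ LinearMap.ker (borderMatrix f B).mulVecLin ↔
      f ⬝ᵥ v = 0 ∧ c • f + B.mulVec v = 0 := by
  have h0 : (0 : Fin (m + 1) → F) = Fin.cons 0 0 := by
    funext i; refine Fin.cases rfl (fun _ => rfl) i
  rw [LinearMap.mem_ker, Matrix.mulVecLin_apply, borderMatrix_mulVec, h0, Fin.cons_inj, neg_eq_zero]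

theorem AltMatrix.mulVec_dotProduct (B : AltMatrix F m) (u v : Fin m → F) :
    B.1.mulVec u ⬝ᵥ v = -(u ⬝ᵥ B.1.mulVec v) := by
  have h : B.1.transpose = -B.1 := by ext i j; exact B.2.2 i j
  rw [dotProduct_comm, Matrix.dotProduct_mulVec, ← Matrix.mulVec_transpose, h, Matrix.neg_mulVec,
    neg_dotProduct, dotProduct_comm]

/-- The terms at `(i, j)` and `(j, i)` cancel and the diagonal is zero, which also covers
characteristic 2. -/
theorem AltMatrix.mulVec_dotProduct_self (B : AltMatrix F m) (u : Fin m → F) :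
    B.1.mulVec u ⬝ᵥ u = 0 := by
  obtain ⟨B, h0, h1⟩ := B
  simp only [dotProduct, Matrix.mulVec, Finset.sum_mul]
  rw [← Finset.sum_product']
  refine Finset.sum_involution (fun p _ => p.swap) ?_ ?_ (by simp) (by simp)
  · rintro ⟨i, j⟩ -
    simp only [Prod.swap_prod_mk, h1 i j]
    ring
  · rintro ⟨i, j⟩ - hne h
    simp only [Prod.swap_prod_mk, Prod.mk.injEq] at h
    obtain ⟨rfl, -⟩ := h
    simp [h0] at hne

/-- If `f = B u`, then `c • f + B v = 0` says that `v + c • u` lies in `ker B`, and the condition `f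
⬝ᵥ v = 0` is then automatic. The new kernel is thus `F × ker B`. -/
theorem nullity_borderMatrix_of_mem (B : AltMatrix F m) {f : Fin m → F}
    (hf : f ∈ LinearMap.range B.1.mulVecLin) :
    nullity (borderMatrix f B.1) = nullity B.1 + 1 := by
  obtain ⟨u, rfl⟩ := hf
  rw [Matrix.mulVecLin_apply]
  let e : (F × LinearMap.ker B.1.mulVecLin) →ₗ[F]
      LinearMap.ker (borderMatrix (B.1.mulVec u) B.1).mulVecLin :=
    { toFun := fun p => ⟨Fin.cons p.1 (p.2.1 - p.1 • u), by
        have hp : B.1.mulVec p.2.1 = 0 := p.2.2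
        rw [cons_mem_ker_borderMatrix]
        constructor
        · rw [dotProduct_sub, dotProduct_smul, B.mulVec_dotProduct_self, B.mulVec_dotProduct, hp]
          simp
        · rw [Matrix.mulVec_sub, hp, Matrix.mulVec_smul]
          simp⟩
      map_add' := fun p p' => by
        ext i
        refine Fin.cases ?_ (fun i => ?_) i
        · simp
        · simp
          ring
      map_smul' := fun c p => by
        ext i
        refine Fin.cases ?_ (fun i => ?_) i
        · simp
        · simp
          ring }
  have he : Function.Bijective e := by
    constructor
    · rintro ⟨c, w⟩ ⟨c', w'⟩ h
      have h1 : (Fin.cons c (w.1 - c • u) : Fin (m + 1) → F) = Fin.cons c' (w'.1 - c' • u) :=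
        congrArg Subtype.val h
      rw [Fin.cons_inj] at h1
      obtain ⟨rfl, h2⟩ := h1
      rw [sub_left_inj] at h2
      rw [Subtype.ext h2]
    · rintro ⟨x, hx⟩
      obtain ⟨c, v, rfl⟩ : ∃ c v, x = Fin.cons c v := ⟨x 0, Fin.tail x, (Fin.cons_self_tail x).symm⟩
      rw [cons_mem_ker_borderMatrix] at hx
      refine ⟨⟨c, ⟨v + c • u, ?_⟩⟩, ?_⟩
      · rw [LinearMap.mem_ker, Matrix.mulVecLin_apply, Matrix.mulVec_add, Matrix.mulVec_smul,
          add_comm, hx.2]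
      · apply Subtype.ext
        simp [e]
  have h := (LinearEquiv.ofBijective e he).finrank_eq
  rw [Module.finrank_prod, Module.finrank_self] at h
  unfold nullity
  omega

/-- A functional that separates `f` from the range of `B` is a dot product with some `w`, and
antisymmetry puts `w` in `ker B`. -/
theorem AltMatrix.exists_dotProduct_ne_zero (B : AltMatrix F m) {f : Fin m → F}
    (hf : f ∉ LinearMap.range B.1.mulVecLin) :
    ∃ w ∈ LinearMap.ker B.1.mulVecLin, f ⬝ᵥ w ≠ 0 := by
  obtain ⟨g, hg, hle⟩ := Submodule.exists_le_ker_of_notMem hf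
  obtain ⟨w, rfl⟩ := (dotProductEquiv F (Fin m)).surjective g
  refine ⟨w, ?_, ?_⟩
  · rw [LinearMap.mem_ker, Matrix.mulVecLin_apply]
    apply dotProduct_eq_zero
    intro u
    rw [B.mulVec_dotProduct, neg_eq_zero]
    exact hle ⟨u, rfl⟩
  · rw [dotProduct_comm]
    exact hg

/-- A kernel vector must have first entry 0, so the new kernel is that of the nonzero functional `f
⬝ᵥ ·` on `ker B`. -/
theorem nullity_borderMatrix_of_notMem (B : AltMatrix F m) {f : Fin m → F}
    (hf : f ∉ LinearMap.range B.1.mulVecLin) :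
    nullity (borderMatrix f B.1) + 1 = nullity B.1 := by
  let φ : LinearMap.ker B.1.mulVecLin →ₗ[F] F :=
    (dotProductEquiv F (Fin m) f).comp (Submodule.subtype _)
  have hφ : Function.Surjective φ := by
    apply LinearMap.surjective
    obtain ⟨w, hw, hne⟩ := B.exists_dotProduct_ne_zero hf
    intro h
    exact hne (LinearMap.congr_fun h ⟨w, hw⟩)
  have h1 := LinearMap.finrank_range_add_finrank_ker φ
  rw [LinearMap.range_eq_top.2 hφ, finrank_top, Module.finrank_self] at h1
  let e : LinearMap.ker φ →ₗ[F] LinearMap.ker (borderMatrix f B.1).mulVecLin :=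
    { toFun := fun w => ⟨Fin.cons 0 w.1.1, by
        rw [cons_mem_ker_borderMatrix]
        have h2 : B.1.mulVec w.1.1 = 0 := w.1.2
        exact ⟨w.2, by simp [h2]⟩⟩
      map_add' := fun p p' => by
        ext i
        refine Fin.cases ?_ (fun i => ?_) i <;> simp
      map_smul' := fun c p => by
        ext i
        refine Fin.cases ?_ (fun i => ?_) i <;> simp }
  have he : Function.Bijective e := by
    constructor
    · intro w w' h
      have h1 : (Fin.cons 0 w.1.1 : Fin (m + 1) → F) = Fin.cons 0 w'.1.1 := congrArg Subtype.val h
      rw [Fin.cons_inj] at h1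
      exact Subtype.ext (Subtype.ext h1.2)
    · rintro ⟨x, hx⟩
      obtain ⟨c, v, rfl⟩ : ∃ c v, x = Fin.cons c v := ⟨x 0, Fin.tail x, (Fin.cons_self_tail x).symm⟩
      have hx' := hx
      rw [cons_mem_ker_borderMatrix] at hx'
      have hc : c = 0 := by
        by_contra hc
        refine hf ⟨-c⁻¹ • v, ?_⟩
        rw [Matrix.mulVecLin_apply, Matrix.mulVec_smul, eq_neg_of_add_eq_zero_right hx'.2, smul_neg,
          neg_smul, neg_neg, smul_smul, inv_mul_cancel₀ hc, one_smul]
      subst hc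
      refine ⟨⟨⟨v, by simpa using hx'.2⟩, hx'.1⟩, rfl⟩
  have h := (LinearEquiv.ofBijective e he).finrank_eq
  unfold nullity
  omega

theorem borderMatrix_alternating (f : Fin m → F) (B : AltMatrix F m) :
    (∀ i, borderMatrix f B.1 i i = 0) ∧
      ∀ i j, borderMatrix f B.1 j i = -borderMatrix f B.1 i j := by
  constructor
  · intro i
    refine Fin.cases ?_ (fun i => ?_) i
    · simp [borderMatrix]
    · simpa [borderMatrix] using B.2.1 i
  · intro i j
    refine Fin.cases ?_ (fun i => ?_) i <;> refine Fin.cases ?_ (fun j => ?_) j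
    · simp [borderMatrix]
    · simp [borderMatrix]
    · simp [borderMatrix]
    · simpa [borderMatrix] using B.2.2 i j

/-- An alternating matrix is a bordered smaller alternating matrix. -/
def borderEquiv (F : Type*) [Field F] (m : ℕ) :
    AltMatrix F m × (Fin m → F) ≃ AltMatrix F (m + 1) where
  toFun p := ⟨borderMatrix p.2 p.1.1, borderMatrix_alternating p.2 p.1⟩
  invFun B := ⟨⟨fun i j => B.1 i.succ j.succ, fun i => B.2.1 i.succ,
      fun i j => B.2.2 i.succ j.succ⟩, fun i => B.1 i.succ 0⟩
  left_inv p := rfl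
  right_inv B := by
    apply Subtype.ext
    ext i j
    refine Fin.cases ?_ (fun i => ?_) i <;> refine Fin.cases ?_ (fun j => ?_) j
    · simpa [borderMatrix] using (B.2.1 0).symm
    · simpa [borderMatrix] using (B.2.2 j.succ 0).symm
    · simp [borderMatrix]
    · simp [borderMatrix]

/-- Each bordering raises the size by one and changes the nullity by plus or minus one. -/
theorem AltMatrix.even_add_nullity (B : AltMatrix F m) : Even (m + nullity B.1) := by
  induction m with
  | zero =>
    have := nullity_le B.1
    rw [Nat.le_zero.1 this]
    exact Even.zero
  | succ m ih =>
    obtain ⟨⟨B, f⟩, rfl⟩ := (borderEquiv F m).surjective B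
    change Even (m + 1 + nullity (borderMatrix f B.1))
    have h := ih B
    by_cases hf : f ∈ LinearMap.range B.1.mulVecLin
    · rw [nullity_borderMatrix_of_mem B hf]
      rw [Nat.even_iff] at *
      omega
    · have h2 := nullity_borderMatrix_of_notMem B hf
      rw [Nat.even_iff] at *
      omega

end

/-! ### Counting alternating matrices by nullity -/

section

variable (F : Type*) [Field F] {m : ℕ}

/-- The number of alternating `m × m` matrices `B` with `m + dim ker B = 2t`, as a real. -/
noncomputable def altCount (m t : ℕ) : ℝ :=
  Nat.card {B : AltMatrix F m // m + nullity B.1 = 2 * t}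

theorem altCount_eq_sum [Fintype (AltMatrix F m)] (t : ℕ) :
    altCount F m t = ∑ B : AltMatrix F m, if m + nullity B.1 = 2 * t then (1 : ℝ) else 0 := by
  classical
  rw [altCount, Nat.card_eq_fintype_card, Fintype.card_subtype, Finset.sum_boole]

theorem altCount_zero (t : ℕ) : altCount F 0 t = if t = 0 then 1 else 0 := by
  classical
  have : Unique (AltMatrix F 0) :=
    ⟨⟨⟨0, by simp, by simp⟩⟩, fun B => Subtype.ext (Subsingleton.elim _ _)⟩
  let _ : Fintype (AltMatrix F 0) := Unique.fintype
  rw [altCount_eq_sum, Fintype.sum_unique]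
  have h := nullity_le (default : AltMatrix F 0).1
  refine if_congr ?_ rfl rfl
  omega

theorem sum_nullity_borderMatrix [Fintype F] (B : AltMatrix F m) (φ : ℕ → ℝ) :
    ∑ f : Fin m → F, φ (nullity (borderMatrix f B.1)) =
      (Nat.card F : ℝ) ^ (m - nullity B.1) * φ (nullity B.1 + 1) +
        ((Nat.card F : ℝ) ^ m - (Nat.card F : ℝ) ^ (m - nullity B.1)) * φ (nullity B.1 - 1) := by
  classical
  have hcard : (Finset.univ.filter fun f : Fin m → F =>
      f ∈ LinearMap.range B.1.mulVecLin).card = Nat.card F ^ (m - nullity B.1) := by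
    have h := Module.natCard_eq_pow_finrank (K := F) (V := LinearMap.range B.1.mulVecLin)
    have h2 := finrank_range_add_nullity B.1
    rw [← Fintype.card_subtype, ← Nat.card_eq_fintype_card]
    change Nat.card (LinearMap.range B.1.mulVecLin) = _
    rw [h]
    congr 1
    omega
  have htot := Finset.card_filter_add_card_filter_not (s := (Finset.univ : Finset (Fin m → F)))
    (fun f => f ∈ LinearMap.range B.1.mulVecLin)
  rw [hcard, Finset.card_univ, ← Nat.card_eq_fintype_card (α := Fin m → F), Nat.card_fun,
    Nat.card_eq_fintype_card (α := Fin m), Fintype.card_fin] at htot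
  rw [← Finset.sum_filter_add_sum_filter_not _ (fun f => f ∈ LinearMap.range B.1.mulVecLin)]
  congr 1
  · rw [Finset.sum_congr rfl (g := fun _ => φ (nullity B.1 + 1)), Finset.sum_const, hcard,
      nsmul_eq_mul, Nat.cast_pow]
    intro f hf
    rw [nullity_borderMatrix_of_mem B (Finset.mem_filter.1 hf).2]
  · rw [Finset.sum_congr rfl (g := fun _ => φ (nullity B.1 - 1)), Finset.sum_const,
      nsmul_eq_mul]
    · congr 1
      rw [eq_sub_iff_add_eq]
      rw [add_comm]
      exact_mod_cast htot
    · intro f hf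
      rw [← nullity_borderMatrix_of_notMem B (Finset.mem_filter.1 hf).2, Nat.add_sub_cancel]

theorem altCount_succ [Finite F] (m t : ℕ) [Fintype (AltMatrix F m)] :
    altCount F (m + 1) t = ∑ B : AltMatrix F m,
      ((Nat.card F : ℝ) ^ (m - nullity B.1) * (if m + nullity B.1 + 2 = 2 * t then 1 else 0) +
        ((Nat.card F : ℝ) ^ m - (Nat.card F : ℝ) ^ (m - nullity B.1)) *
          (if m + nullity B.1 = 2 * t then 1 else 0)) := by
  classical
  let _ : Fintype F := Fintype.ofFinite F
  rw [altCount_eq_sum, ← (borderEquiv F m).sum_comp, Fintype.sum_prod_type]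
  refine Finset.sum_congr rfl fun B _ => ?_
  refine (sum_nullity_borderMatrix F B fun s => if m + 1 + s = 2 * t then (1 : ℝ) else 0).trans ?_
  congr 1
  · congr 1
    exact if_congr (by omega) rfl rfl
  -- At nullity 0 the truncated `nullity B.1 - 1` is meaningless, but its coefficient is zero.
  · rcases Nat.eq_zero_or_pos (nullity B.1) with h | h
    · rw [h, Nat.sub_zero, sub_self, zero_mul, zero_mul]
    · congr 1
      exact if_congr (by omega) rfl rfl

theorem altCount_succ_zero [Finite F] (m : ℕ) :
    altCount F (m + 1) 0 =
      ((Nat.card F : ℝ) ^ m - (Nat.card F : ℝ) ^ (2 * m)) * altCount F m 0 := by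
  classical
  let _ : Fintype (AltMatrix F m) := Fintype.ofFinite _
  rw [altCount_succ, altCount_eq_sum, Finset.mul_sum]
  refine Finset.sum_congr rfl fun B _ => ?_
  rw [if_neg (by omega), mul_zero, zero_add]
  split_ifs with h
  · obtain rfl : m = 0 := by omega
    simp
  · simp

/-- A column in the range, one of `q ^ (m - nullity)`, raises `t` by one; any other column keeps
`t`. The factor `q ^ (2 * (t + 1))` keeps all exponents natural. -/
theorem altCount_succ_succ [Finite F] (m t : ℕ) :
    (Nat.card F : ℝ) ^ (2 * (t + 1)) * altCount F (m + 1) (t + 1) =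
      (Nat.card F : ℝ) ^ (2 * m + 2) * altCount F m t +
        ((Nat.card F : ℝ) ^ (m + 2 * (t + 1)) - (Nat.card F : ℝ) ^ (2 * m)) *
          altCount F m (t + 1) := by
  classical
  let _ : Fintype (AltMatrix F m) := Fintype.ofFinite _
  rw [altCount_succ, altCount_eq_sum, altCount_eq_sum, Finset.mul_sum, Finset.mul_sum,
    Finset.mul_sum, ← Finset.sum_add_distrib]
  refine Finset.sum_congr rfl fun B _ => ?_
  have hle := nullity_le B.1
  rw [mul_add]
  congr 1
  · rw [← mul_assoc, ← pow_add]
    by_cases h : m + nullity B.1 = 2 * t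
    · rw [if_pos h, if_pos (by omega), show 2 * (t + 1) + (m - nullity B.1) = 2 * m + 2 by omega]
    · rw [if_neg h, if_neg (by omega), mul_zero, mul_zero]
  · by_cases h : m + nullity B.1 = 2 * (t + 1)
    · rw [if_pos h, mul_one, mul_one, mul_sub, ← pow_add, ← pow_add,
        show 2 * (t + 1) + (m - nullity B.1) = 2 * m by omega, add_comm m]
    · rw [if_neg h, mul_zero, mul_zero, mul_zero]

theorem card_altMatrix_le [Finite F] (m n : ℕ) :
    (Nat.card {B : AltMatrix F m // m + nullity B.1 ≤ 2 * n} : ℝ) =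
      ∑ t ∈ Finset.range (n + 1), altCount F m t := by
  classical
  let _ : Fintype (AltMatrix F m) := Fintype.ofFinite _
  simp only [altCount_eq_sum]
  rw [Nat.card_eq_fintype_card, Fintype.card_subtype, Finset.sum_comm, ← Finset.sum_boole]
  refine Finset.sum_congr rfl fun B _ => ?_
  obtain ⟨s, hs⟩ := B.even_add_nullity
  have : ∀ t, (if m + nullity B.1 = 2 * t then (1 : ℝ) else 0) = if s = t then 1 else 0 :=
    fun t => if_congr (by omega) rfl rfl
  simp only [this, Finset.sum_ite_eq, Finset.mem_range]
  exact if_congr (by omega) rfl rfl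

end

/-! ### Witt's theorem and Gram matrices -/

section

variable {F V : Type*} [Field F] [AddCommGroup V] [Module F V]

/-- The symplectic transvection `v ↦ v + c ω(v, z) z`. -/
def symplecticTransvection (ω : LinearMap.BilinForm F V) (c : F) (z : V) : V →ₗ[F] V :=
  LinearMap.id + c • (ω.flip z).smulRight z

theorem symplecticTransvection_apply (ω : LinearMap.BilinForm F V) (c : F) (z v : V) :
    symplecticTransvection ω c z v = v + c • ω v z • z := rfl

theorem symplecticTransvection_isometry {ω : LinearMap.BilinForm F V} (ha : ω.IsAlt) (c : F)
    (z v w : V) :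
    ω (symplecticTransvection ω c z v) (symplecticTransvection ω c z w) = ω v w := by
  simp only [symplecticTransvection_apply, map_add, map_smul, LinearMap.add_apply,
    LinearMap.smul_apply, smul_eq_mul, ha.self_eq_zero z]
  rw [← ha.neg_eq z w]
  ring

/-- The transvection along `y - x`, scaled by `(ω x y)⁻¹`, moves `x` to `y`; it fixes `W` because `y
- x` is orthogonal to `W`. -/
theorem exists_isometry_of_apply_ne_zero {ω : LinearMap.BilinForm F V} (ha : ω.IsAlt)
    (W : Submodule F V) {x y : V} (hW : ∀ w ∈ W, ω w x = ω w y) (hxy : ω x y ≠ 0) :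
    ∃ T : V →ₗ[F] V, (∀ v w, ω (T v) (T w) = ω v w) ∧ (∀ w ∈ W, T w = w) ∧ T x = y := by
  refine ⟨symplecticTransvection ω (ω x y)⁻¹ (y - x), symplecticTransvection_isometry ha _ _,
    fun w hw => ?_, ?_⟩
  · rw [symplecticTransvection_apply, map_sub, hW w hw, sub_self, zero_smul, smul_zero, add_zero]
  · rw [symplecticTransvection_apply, map_sub, ha.self_eq_zero x, sub_zero, smul_smul,
      inv_mul_cancel₀ hxy, one_smul, add_sub_cancel]

theorem isometry_injective {ω : LinearMap.BilinForm F V} (hn : ω.Nondegenerate)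
    {T : V →ₗ[F] V} (hT : ∀ v w, ω (T v) (T w) = ω v w) : LinearMap.ker T = ⊥ := by
  refine (Submodule.eq_bot_iff _).2 fun v hv => ?_
  refine hn.1 v fun w => ?_
  rw [← hT, LinearMap.mem_ker.1 hv, map_zero, LinearMap.zero_apply]

/-- The Gram matrix of a tuple with respect to an alternating form. -/
def gramAlt (ω : LinearMap.BilinForm F V) (ha : ω.IsAlt) {m : ℕ} (x : Fin m → V) :
    AltMatrix F m :=
  ⟨Matrix.of fun i j => ω (x i) (x j), fun i => ha.self_eq_zero (x i),
    fun i j => (ha.neg_eq (x i) (x j)).symm⟩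

theorem gramAlt_mulVec (ω : LinearMap.BilinForm F V) (ha : ω.IsAlt) {m : ℕ} (x : Fin m → V)
    (u : Fin m → F) (i : Fin m) :
    (gramAlt ω ha x).1.mulVec u i = ω (x i) (∑ j, u j • x j) := by
  simp [gramAlt, Matrix.mulVec, dotProduct, map_sum, mul_comm]

theorem mem_orthogonal_span_range {ω : LinearMap.BilinForm F V} {m : ℕ} {x : Fin m → V} {t : V} :
    t ∈ ω.orthogonal (Submodule.span F (Set.range x)) ↔ ∀ i, ω (x i) t = 0 := by
  rw [LinearMap.BilinForm.mem_orthogonal_iff]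
  refine ⟨fun h i => h _ (Submodule.subset_span ⟨i, rfl⟩), fun h w hw => ?_⟩
  refine Submodule.span_induction (p := fun w _ => ω w t = 0) ?_ (by simp) ?_ ?_ hw
  · rintro _ ⟨i, rfl⟩
    exact h i
  · intro u v _ _ hu hv
    rw [map_add, LinearMap.add_apply, hu, hv, add_zero]
  · intro c u _ hu
    rw [map_smul, LinearMap.smul_apply, hu, smul_zero]

/-- The kernel of the Gram matrix, mapped to the orthogonal complement of the tuple. -/
def gramKerMap (ω : LinearMap.BilinForm F V) (ha : ω.IsAlt) {m : ℕ} (x : Fin m → V) :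
    LinearMap.ker (gramAlt ω ha x).1.mulVecLin →ₗ[F]
      ω.orthogonal (Submodule.span F (Set.range x)) :=
  ((Fintype.linearCombination F x).comp (Submodule.subtype _)).codRestrict _ fun u => by
    rw [mem_orthogonal_span_range]
    intro i
    have h := congrFun (LinearMap.mem_ker.1 u.2) i
    rw [Matrix.mulVecLin_apply, gramAlt_mulVec] at h
    exact h

theorem gramKerMap_injective {ω : LinearMap.BilinForm F V} (ha : ω.IsAlt) {m : ℕ}
    {x : Fin m → V} (hx : LinearIndependent F x) : Function.Injective (gramKerMap ω ha x) := by
  intro u v h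
  have h1 : Fintype.linearCombination F x u.1 = Fintype.linearCombination F x v.1 :=
    congrArg Subtype.val h
  exact Subtype.ext (hx.fintypeLinearCombination_injective h1)

variable [FiniteDimensional F V]

theorem exists_orthogonal_apply_ne_zero {ω : LinearMap.BilinForm F V} (hn : ω.Nondegenerate)
    (ha : ω.IsAlt) {W : Submodule F V} {x : V} (hx : x ∉ W) :
    ∃ t ∈ ω.orthogonal W, ω x t ≠ 0 := by
  rw [← LinearMap.BilinForm.orthogonal_orthogonal hn ha.isRefl W,
    LinearMap.BilinForm.mem_orthogonal_iff] at hx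
  push Not at hx
  obtain ⟨t, ht, h⟩ := hx
  exact ⟨t, ht, fun h0 => h (ha.isRefl x t h0)⟩

theorem exists_orthogonal_apply_ne_zero_pair {ω : LinearMap.BilinForm F V} (hn : ω.Nondegenerate)
    (ha : ω.IsAlt) {W : Submodule F V} {x y : V} (hx : x ∉ W) (hy : y ∉ W) :
    ∃ t ∈ ω.orthogonal W, ω x t ≠ 0 ∧ ω y t ≠ 0 := by
  obtain ⟨t, ht, h1⟩ := exists_orthogonal_apply_ne_zero hn ha hx
  obtain ⟨s, hs, h2⟩ := exists_orthogonal_apply_ne_zero hn ha hy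
  by_cases h3 : ω y t = 0
  · by_cases h4 : ω x s = 0
    · exact ⟨t + s, add_mem ht hs, by simpa [h4] using h1, by simpa [h3] using h2⟩
    · exact ⟨s, hs, h4, h2⟩
  · exact ⟨t, ht, h1, h3⟩

/-- When `ω x y = 0` no single transvection is available. Two are composed, through `x + t` with `t`
orthogonal to `W` and to neither `x` nor `y`. -/
theorem exists_isometry_fixing {ω : LinearMap.BilinForm F V} (hn : ω.Nondegenerate)
    (ha : ω.IsAlt) (W : Submodule F V) {x y : V} (hx : x ∉ W) (hy : y ∉ W)
    (hW : ∀ w ∈ W, ω w x = ω w y) :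
    ∃ T : V →ₗ[F] V, (∀ v w, ω (T v) (T w) = ω v w) ∧ (∀ w ∈ W, T w = w) ∧ T x = y := by
  by_cases hxy : ω x y = 0
  · obtain ⟨t, ht, h1, h2⟩ := exists_orthogonal_apply_ne_zero_pair hn ha hx hy
    have ht' : ∀ w ∈ W, ω w t = 0 := (LinearMap.BilinForm.mem_orthogonal_iff).1 ht
    have e : ω (x + t) y = -ω y t := by
      rw [map_add, LinearMap.add_apply, hxy, zero_add, ha.neg_eq]
    obtain ⟨T, hT, hTW, hTx⟩ := exists_isometry_of_apply_ne_zero ha W (x := x) (y := x + t)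
      (fun w hw => by rw [map_add, ht' w hw, add_zero])
      (by rw [map_add, ha.self_eq_zero x, zero_add]; exact h1)
    obtain ⟨S, hS, hSW, hSx⟩ := exists_isometry_of_apply_ne_zero ha W (x := x + t) (y := y)
      (fun w hw => by rw [map_add, ht' w hw, add_zero, hW w hw])
      (by rw [e]; exact neg_ne_zero.2 h2)
    refine ⟨S.comp T, fun v w => ?_, fun w hw => ?_, ?_⟩
    · rw [LinearMap.comp_apply, LinearMap.comp_apply, hS, hT]
    · rw [LinearMap.comp_apply, hTW w hw, hSW w hw]
    · rw [LinearMap.comp_apply, hTx, hSx]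
  · exact exists_isometry_of_apply_ne_zero ha W hW hxy

/-- Witt's theorem for linearly independent tuples with the same Gram matrix. -/
theorem exists_isometry_of_gram_eq {ω : LinearMap.BilinForm F V} (hn : ω.Nondegenerate)
    (ha : ω.IsAlt) {m : ℕ} {x y : Fin m → V} (hx : LinearIndependent F x)
    (hy : LinearIndependent F y) (h : ∀ i j, ω (x i) (x j) = ω (y i) (y j)) :
    ∃ T : V →ₗ[F] V, (∀ v w, ω (T v) (T w) = ω v w) ∧ ∀ i, T (x i) = y i := by
  induction m with
  | zero => exact ⟨LinearMap.id, fun _ _ => rfl, fun i => i.elim0⟩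
  | succ m ih =>
    have hx' := hx.comp _ (Fin.succ_injective m)
    have hy' := hy.comp _ (Fin.succ_injective m)
    obtain ⟨T, hT, hTx⟩ := ih hx' hy' fun i j => h i.succ j.succ
    have hTI := hx.map' T (isometry_injective hn hT)
    rw [← Fin.cons_self_tail y, linearIndependent_finCons] at hy
    have e : (T ∘ x) = Fin.cons (T (x 0)) (Fin.tail y) := by
      funext i
      refine Fin.cases rfl (fun i => hTx i) i
    rw [e, linearIndependent_finCons] at hTI
    -- `T` already matches the tails; `S` corrects the image of the first vector while fixing the
    -- span of the tail.
    obtain ⟨S, hS, hSW, hSx⟩ := exists_isometry_fixing hn ha _ hTI.2 hy.2 (by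
      intro w hw
      refine Submodule.span_induction (p := fun w _ => ω w (T (x 0)) = ω w (y 0))
        ?_ (by simp) ?_ ?_ hw
      · rintro _ ⟨i, rfl⟩
        have h1 : Fin.tail y i = T (x i.succ) := (hTx i).symm
        rw [h1, hT, h]
        rw [← h1]
        rfl
      · intro u v _ _ hu hv
        rw [map_add, LinearMap.add_apply, LinearMap.add_apply, hu, hv]
      · intro c u _ hu
        rw [map_smul, LinearMap.smul_apply, LinearMap.smul_apply, hu])
    refine ⟨S.comp T, fun v w => ?_, fun i => ?_⟩
    · rw [LinearMap.comp_apply, LinearMap.comp_apply, hS, hT]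
    · refine Fin.cases hSx (fun i => ?_) i
      have h1 : T (x i.succ) = Fin.tail y i := hTx i
      rw [LinearMap.comp_apply, h1, hSW _ (Submodule.subset_span ⟨i, rfl⟩)]
      rfl

/-- A kernel vector of the Gram matrix is a relation placing a combination of the tuple in the
orthogonal complement of its span, which has dimension `dim V - m`. -/
theorem add_nullity_gramAlt_le {ω : LinearMap.BilinForm F V} (hn : ω.Nondegenerate)
    (ha : ω.IsAlt) {m : ℕ} {x : Fin m → V} (hx : LinearIndependent F x) :
    m + nullity (gramAlt ω ha x).1 ≤ Module.finrank F V := by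
  have h1 := LinearMap.finrank_le_finrank_of_injective (gramKerMap_injective ha hx)
  rw [LinearMap.BilinForm.finrank_orthogonal hn, finrank_span_eq_card hx, Fintype.card_fin] at h1
  have h2 := hx.fintype_card_le_finrank
  rw [Fintype.card_fin] at h2
  unfold nullity
  omega

theorem add_nullity_gramAlt_of_le {ω : LinearMap.BilinForm F V} (hn : ω.Nondegenerate)
    (ha : ω.IsAlt) {m : ℕ} {x : Fin m → V} (hx : LinearIndependent F x)
    (hW : ω.orthogonal (Submodule.span F (Set.range x)) ≤ Submodule.span F (Set.range x)) :
    Module.finrank F V ≤ m + nullity (gramAlt ω ha x).1 := by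
  have hs : Function.Surjective (gramKerMap ω ha x) := by
    rintro ⟨t, ht⟩
    obtain ⟨u, rfl⟩ := Submodule.mem_span_range_iff_exists_fun F |>.1 (hW ht)
    rw [mem_orthogonal_span_range] at ht
    refine ⟨⟨u, ?_⟩, rfl⟩
    rw [LinearMap.mem_ker, Matrix.mulVecLin_apply]
    funext i
    rw [gramAlt_mulVec]
    exact ht i
  have h1 := LinearMap.finrank_le_finrank_of_surjective (f := gramKerMap ω ha x) hs
  rw [LinearMap.BilinForm.finrank_orthogonal hn, finrank_span_eq_card hx, Fintype.card_fin] at h1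
  unfold nullity
  omega

theorem exists_forall_form_apply_eq {ω : LinearMap.BilinForm F V} (hn : ω.Nondegenerate)
    (ha : ω.IsAlt) {m : ℕ} {x : Fin m → V} (hx : LinearIndependent F x) (f : Fin m → F) :
    ∃ v, ∀ i, ω (x i) v = f i := by
  obtain ⟨g, hg⟩ := LinearMap.exists_extend ((Module.Basis.span hx).constr F f)
  obtain ⟨v, rfl⟩ := (LinearMap.BilinForm.toDual ω hn).surjective g
  -- `toDual` represents a functional through the left argument of `ω`; moving to the right one
  -- costs a sign.
  refine ⟨-v, fun i => ?_⟩
  have h := LinearMap.congr_fun hg (Module.Basis.span hx i)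
  rw [Module.Basis.constr_basis, LinearMap.comp_apply, Submodule.subtype_apply,
    Module.Basis.span_apply, LinearMap.BilinForm.toDual_def] at h
  rw [map_neg, ha.neg_eq, h]

/-- An alternating matrix is the Gram matrix of a linearly independent tuple as soon as the
dimension allows it. -/
theorem exists_gramAlt_eq {ω : LinearMap.BilinForm F V} (hn : ω.Nondegenerate)
    (ha : ω.IsAlt) {m : ℕ} (B : AltMatrix F m) (hB : m + nullity B.1 ≤ Module.finrank F V) :
    ∃ x : Fin m → V, LinearIndependent F x ∧ gramAlt ω ha x = B := by
  induction m with
  | zero =>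
    exact ⟨fun i => i.elim0, linearIndependent_empty_type,
      Subtype.ext (Matrix.ext fun i => i.elim0)⟩
  | succ m ih =>
    obtain ⟨⟨B, f⟩, rfl⟩ := (borderEquiv F m).surjective B
    change m + 1 + nullity (borderMatrix f B.1) ≤ _ at hB
    have hle : m + nullity B.1 ≤ Module.finrank F V := by
      by_cases hf : f ∈ LinearMap.range B.1.mulVecLin
      · rw [nullity_borderMatrix_of_mem B hf] at hB
        omega
      · have := nullity_borderMatrix_of_notMem B hf
        omega
    obtain ⟨x, hx, rfl⟩ := ih B hle
    suffices h : ∃ v, (∀ i, ω (x i) v = f i) ∧ v ∉ Submodule.span F (Set.range x) by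
      obtain ⟨v, hv, hvx⟩ := h
      refine ⟨Fin.cons v x, linearIndependent_finCons.2 ⟨hx, hvx⟩, Subtype.ext ?_⟩
      ext i j
      refine Fin.cases ?_ (fun i => ?_) i <;> refine Fin.cases ?_ (fun j => ?_) j
      · simpa [borderEquiv, borderMatrix, gramAlt] using ha.self_eq_zero v
      · simp [borderEquiv, borderMatrix, gramAlt, ← hv, ha.neg_eq]
      · simp [borderEquiv, borderMatrix, gramAlt, hv]
      · simp [borderEquiv, borderMatrix, gramAlt]
    -- The solutions `v` form a coset of the orthogonal complement of the span. If all lie in the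
    -- span, then so does the complement, whence `dim V ≤ m + nullity`; also `f` is in the range, so
    -- bordering raises the nullity and violates `hB`.
    by_contra! hall
    obtain ⟨v, hv⟩ := exists_forall_form_apply_eq hn ha hx f
    have hvW := hall v hv
    have hf : f ∈ LinearMap.range (gramAlt ω ha x).1.mulVecLin := by
      obtain ⟨u, rfl⟩ := Submodule.mem_span_range_iff_exists_fun F |>.1 hvW
      refine ⟨u, ?_⟩
      funext i
      rw [Matrix.mulVecLin_apply, gramAlt_mulVec, hv]
    have hW : ω.orthogonal (Submodule.span F (Set.range x)) ≤ Submodule.span F (Set.range x) := by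
      intro t ht
      rw [mem_orthogonal_span_range] at ht
      have := hall (v + t) fun i => by rw [map_add, hv, ht, add_zero]
      simpa using sub_mem this hvW
    have h1 := add_nullity_gramAlt_of_le hn ha hx hW
    rw [nullity_borderMatrix_of_mem _ hf] at hB
    omega

end

/-! ### The symplectic group, its orbits and Burnside's lemma -/

section

variable (F : Type*) [Field F] (n : ℕ)

/-- The standard symplectic form on `F^{2n}`. -/
noncomputable def stdForm : LinearMap.BilinForm F (Fin n ⊕ Fin n → F) :=
  Matrix.toBilin' (Matrix.J (Fin n) F)

theorem stdForm_apply (v w : Fin n ⊕ Fin n → F) :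
    stdForm F n v w = v ⬝ᵥ (Matrix.J (Fin n) F).mulVec w :=
  Matrix.toBilin'_apply' _ _ _

theorem stdForm_nondegenerate : (stdForm F n).Nondegenerate :=
  LinearMap.BilinForm.nondegenerate_toBilin'_of_det_ne_zero' _ (Matrix.isUnit_det_J _ _).ne_zero

theorem stdForm_isAlt : (stdForm F n).IsAlt := by
  intro v
  rw [stdForm_apply]
  simp [Matrix.J, Matrix.mulVec, dotProduct, Fintype.sum_sum_type, Matrix.one_apply, mul_comm]

variable {F n}

theorem Sp.stdForm_mulVec (g : Sp n F) (v w : Fin n ⊕ Fin n → F) :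
    stdForm F n (g.1.mulVec v) (g.1.mulVec w) = stdForm F n v w := by
  rw [stdForm_apply, stdForm_apply, Matrix.mulVec_mulVec, Matrix.dotProduct_mulVec,
    Matrix.vecMul_mulVec, ← Matrix.dotProduct_mulVec]
  rw [← Matrix.mul_assoc, SymplecticGroup.mem_iff'.1 g.2]

theorem Sp.exists_of_isometry {T : (Fin n ⊕ Fin n → F) →ₗ[F] (Fin n ⊕ Fin n → F)}
    (hT : ∀ v w, stdForm F n (T v) (T w) = stdForm F n v w) :
    ∃ g : Sp n F, ∀ v, g.1.mulVec v = T v := by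
  refine ⟨⟨LinearMap.toMatrix' T, SymplecticGroup.mem_iff'.2 ?_⟩, fun v =>
    LinearMap.toMatrix'_mulVec T v⟩
  apply (Matrix.toBilin' (R₁ := F) (n := Fin n ⊕ Fin n)).injective
  refine LinearMap.ext fun v => LinearMap.ext fun w => ?_
  have h := hT v w
  rw [← LinearMap.toMatrix'_mulVec T v, ← LinearMap.toMatrix'_mulVec T w, stdForm_apply,
    Matrix.mulVec_mulVec, Matrix.dotProduct_mulVec, Matrix.vecMul_mulVec,
    ← Matrix.dotProduct_mulVec, ← Matrix.mul_assoc] at h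
  rw [Matrix.toBilin'_apply', h]
  rfl

theorem Sp.mulVec_ker (g : Sp n F) : LinearMap.ker g.1.mulVecLin = ⊥ :=
  isometry_injective (stdForm_nondegenerate F n) g.stdForm_mulVec

/-- The linearly independent `m`-tuples in `F^{2n}`. -/
abbrev IndepTuple (F : Type*) [Field F] (n m : ℕ) : Type _ :=
  {x : Fin m → Fin n ⊕ Fin n → F // LinearIndependent F x}

noncomputable instance IndepTuple.mulAction (m : ℕ) : MulAction (Sp n F) (IndepTuple F n m) where
  smul g x := ⟨fun i => g.1.mulVec (x.1 i), x.2.map' g.1.mulVecLin g.mulVec_ker⟩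
  one_smul x := Subtype.ext (funext fun i => Matrix.one_mulVec (x.1 i))
  mul_smul g h x := Subtype.ext (funext fun i => (Matrix.mulVec_mulVec (x.1 i) g.1 h.1).symm)

theorem IndepTuple.smul_apply {m : ℕ} (g : Sp n F) (x : IndepTuple F n m) (i : Fin m) :
    (g • x).1 i = g.1.mulVec (x.1 i) := rfl

/-- The orbits of the symplectic group on independent tuples are classified by Gram matrices. -/
theorem card_orbits_indepTuple (m : ℕ) :
    Nat.card (MulAction.orbitRel.Quotient (Sp n F) (IndepTuple F n m)) =
      Nat.card {B : AltMatrix F m // m + nullity B.1 ≤ 2 * n} := by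
  have hd : Module.finrank F (Fin n ⊕ Fin n → F) = 2 * n := by simp [two_mul]
  have hn := stdForm_nondegenerate F n
  have ha := stdForm_isAlt F n
  let γ : IndepTuple F n m → {B : AltMatrix F m // m + nullity B.1 ≤ 2 * n} := fun x =>
    ⟨gramAlt (stdForm F n) ha x.1, (add_nullity_gramAlt_le hn ha x.2).trans_eq hd⟩
  have hγ : ∀ x y, γ x = γ y ↔ x ∈ MulAction.orbit (Sp n F) y := by
    intro x y
    constructor
    · intro h
      have h1 : ∀ i j, stdForm F n (y.1 i) (y.1 j) = stdForm F n (x.1 i) (x.1 j) := fun i j =>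
        (congrArg (fun B => B.1.1 i j) h).symm
      obtain ⟨T, hT, hTx⟩ := exists_isometry_of_gram_eq hn ha y.2 x.2 h1
      obtain ⟨g, hg⟩ := Sp.exists_of_isometry hT
      exact ⟨g, Subtype.ext (funext fun i => (hg _).trans (hTx i))⟩
    · rintro ⟨g, rfl⟩
      refine Subtype.ext (Subtype.ext (Matrix.ext fun i j => ?_))
      exact g.stdForm_mulVec _ _
  refine Nat.card_congr (Equiv.ofBijective (Quotient.lift γ fun x y h => (hγ x y).2 h) ⟨?_, ?_⟩)
  · intro x y
    induction x using Quotient.inductionOn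
    induction y using Quotient.inductionOn
    intro h
    exact Quotient.sound ((hγ _ _).1 h)
  · intro B
    obtain ⟨x, hx, hB⟩ := exists_gramAlt_eq hn ha B.1 (B.2.trans_eq hd.symm)
    exact ⟨Quotient.mk _ ⟨x, hx⟩, Subtype.ext hB⟩

/-- The fixed space of a symplectic matrix. -/
def fixedSpace (g : Sp n F) : Submodule F (Fin n ⊕ Fin n → F) :=
  LinearMap.eqLocus g.1.mulVecLin LinearMap.id

theorem finrank_fixedSpace_le (g : Sp n F) : Module.finrank F (fixedSpace g) ≤ 2 * n := by
  have h := Submodule.finrank_le (fixedSpace g)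
  rwa [Module.finrank_fintype_fun_eq_card, Fintype.card_sum, Fintype.card_fin, ← two_mul] at h

theorem fixedVectorCount_eq [Finite F] (g : Sp n F) :
    fixedVectorCount g = Nat.card F ^ Module.finrank F (fixedSpace g) :=
  Module.natCard_eq_pow_finrank (K := F) (V := fixedSpace g)

theorem card_linearIndependent_eq_tupleCount [Finite F] {V : Type*} [AddCommGroup V] [Module F V]
    [Finite V] (m : ℕ) :
    (Nat.card {s : Fin m → V // LinearIndependent F s} : ℝ) =
      tupleCount (Nat.card F) m (Module.finrank F V) := by
  let _ : Fintype F := Fintype.ofFinite F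
  rcases le_or_gt m (Module.finrank F V) with h | h
  · rw [card_linearIndependent h, tupleCount, Finset.prod_range, Nat.cast_prod]
    refine Finset.prod_congr rfl fun i _ => ?_
    rw [Nat.cast_sub (Nat.pow_le_pow_right Fintype.card_pos (i.2.le.trans h)),
      Nat.card_eq_fintype_card]
    push_cast
    rfl
  · rw [tupleCount_eq_zero _ h]
    have : IsEmpty {s : Fin m → V // LinearIndependent F s} := ⟨fun s => by
      have := s.2.fintype_card_le_finrank
      rw [Fintype.card_fin] at this
      omega⟩
    simp

theorem card_fixedBy_indepTuple [Finite F] (m : ℕ) (g : Sp n F) :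
    (Nat.card (MulAction.fixedBy (IndepTuple F n m) g) : ℝ) =
      tupleCount (Nat.card F) m (Module.finrank F (fixedSpace g)) := by
  rw [← card_linearIndependent_eq_tupleCount]
  congr 1
  refine Nat.card_congr
    { toFun := fun x => ⟨fun i => ⟨x.1.1 i, congrFun (congrArg Subtype.val x.2) i⟩,
        LinearIndependent.of_comp (fixedSpace g).subtype x.1.2⟩
      invFun := fun s => ⟨⟨fun i => (s.1 i).1, s.2.map' _ (Submodule.ker_subtype _)⟩,
        Subtype.ext (funext fun i => (s.1 i).2)⟩
      left_inv := fun _ => rfl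
      right_inv := fun _ => rfl }

/-- Burnside's lemma: the factorial moments of the fixed-space dimension. -/
theorem sum_tupleCount_fixedSpace [Finite F] (m : ℕ) :
    ∑ g : Sp n F, tupleCount (Nat.card F) m (Module.finrank F (fixedSpace g)) =
      Fintype.card (Sp n F) * ∑ t ∈ Finset.range (n + 1), altCount F m t := by
  classical
  let _ : Fintype (IndepTuple F n m) := Fintype.ofFinite _
  let _ : Fintype (MulAction.orbitRel.Quotient (Sp n F) (IndepTuple F n m)) := Fintype.ofFinite _
  have h := MulAction.sum_card_fixedBy_eq_card_orbits_mul_card_group (Sp n F) (IndepTuple F n m)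
  rw [← Nat.card_eq_fintype_card (α := MulAction.orbitRel.Quotient _ _),
    card_orbits_indepTuple] at h
  rw [← card_altMatrix_le, mul_comm]
  rw [← Nat.cast_mul, ← h, Nat.cast_sum]
  refine Finset.sum_congr rfl fun g _ => ?_
  rw [← card_fixedBy_indepTuple, Nat.card_eq_fintype_card]

end

/-! ### Inversion of the moments and the law of the fixed space -/

/-- The system is triangular: `tupleCount q m d` vanishes for `d < m` but not for `d = m`, so the
moment at the top index isolates the top value. -/
theorem eq_zero_of_sum_mul_tupleCount_eq_zero {q : ℝ} (hq : 1 < q) (N : ℕ) (f : ℕ → ℝ)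
    (h : ∀ m, ∑ d ∈ Finset.range N, f d * tupleCount q m d = 0) : ∀ d < N, f d = 0 := by
  induction N with
  | zero => simp
  | succ N ih =>
    have hN : f N = 0 := by
      have h1 := h N
      rw [Finset.sum_range_succ, Finset.sum_eq_zero, zero_add] at h1
      · exact (mul_eq_zero.1 h1).resolve_right (tupleCount_self_ne_zero hq N)
      · intro d hd
        rw [tupleCount_eq_zero q (Finset.mem_range.1 hd), mul_zero]
    intro d hd
    rcases Nat.lt_succ_iff_lt_or_eq.1 hd with hd | rfl
    · refine ih (fun m => ?_) d hd
      have h1 := h m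
      rwa [Finset.sum_range_succ, hN, zero_mul, add_zero] at h1
    · exact hN

section

variable {F : Type*} [Field F] [Finite F]

theorem one_lt_natCard_cast (F : Type*) [Field F] [Finite F] : (1 : ℝ) < Nat.card F :=
  Nat.one_lt_cast.2 Finite.one_lt_card

/-- The distribution of the dimension of the fixed space in `Sp(2n, q)`. -/
theorem card_finrank_fixedSpace_eq (n d : ℕ) :
    ((Finset.univ.filter fun g : Sp n F => Module.finrank F (fixedSpace g) = d).card : ℝ) /
        Fintype.card (Sp n F) =
      ∑ t ∈ Finset.range (n + 1), fixCoeff (Nat.card F) t d := by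
  have hq := one_lt_natCard_cast F
  have hG : (Fintype.card (Sp n F) : ℝ) ≠ 0 := Nat.cast_ne_zero.2 Fintype.card_ne_zero
  set q : ℝ := ((Nat.card F : ℕ) : ℝ)
  -- The range must contain `d`, every possible fixed-space dimension and the support of every
  -- increment up to `n`.
  set N := max (d + 1) (2 * n + 1) with hN
  rw [← sub_eq_zero]
  refine eq_zero_of_sum_mul_tupleCount_eq_zero hq N (fun d =>
    ((Finset.univ.filter fun g : Sp n F => Module.finrank F (fixedSpace g) = d).card : ℝ) /
      Fintype.card (Sp n F) - ∑ t ∈ Finset.range (n + 1), fixCoeff q t d) (fun m => ?_) d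
    (by omega)
  have h1 : ∑ e ∈ Finset.range N,
      ((Finset.univ.filter fun g : Sp n F => Module.finrank F (fixedSpace g) = e).card : ℝ) *
        tupleCount q m e = ∑ g : Sp n F, tupleCount q m (Module.finrank F (fixedSpace g)) := by
    rw [← Finset.sum_fiberwise_of_maps_to (s := Finset.univ) (t := Finset.range N)
      (g := fun g : Sp n F => Module.finrank F (fixedSpace g))]
    · refine Finset.sum_congr rfl fun e _ => ?_
      rw [Finset.sum_congr rfl (g := fun _ => tupleCount q m e), Finset.sum_const, nsmul_eq_mul]
      intro g hg
      rw [(Finset.mem_filter.1 hg).2]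
    · intro g _
      have := finrank_fixedSpace_le g
      rw [Finset.mem_range]
      omega
  have h2 : ∑ e ∈ Finset.range N, (∑ t ∈ Finset.range (n + 1), fixCoeff q t e) * tupleCount q m e =
      ∑ t ∈ Finset.range (n + 1), altCount F m t := by
    simp only [Finset.sum_mul]
    rw [Finset.sum_comm]
    refine Finset.sum_congr rfl fun t ht => ?_
    have := Finset.mem_range.1 ht
    exact sum_fixCoeff_mul_tupleCount hq (altCount F) (altCount_zero F) (altCount_succ_zero F)
      (altCount_succ_succ F) m t N (by omega)
  simp only [sub_mul, Finset.sum_sub_distrib, h2, div_mul_eq_mul_div]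
  rw [← Finset.sum_div, h1, sum_tupleCount_fixedSpace, mul_div_cancel_left₀ _ hG, sub_self]

theorem pow_natCard_mem_pair_iff (k d : ℕ) :
    Nat.card F ^ d ∈ ({Nat.card F ^ (2 * k), Nat.card F ^ (2 * k + 1)} : Set ℕ) ↔
      d = 2 * k ∨ d = 2 * k + 1 := by
  have h := Nat.pow_right_injective (Finite.one_lt_card (α := F))
  rw [Set.mem_insert_iff, Set.mem_singleton_iff, h.eq_iff, h.eq_iff]

theorem toMeasure_map_fixedVectorCount (n k : ℕ) :
    ((PMF.uniformOfFintype (Sp n F)).map fixedVectorCount).toMeasure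
        {Nat.card F ^ (2 * k), Nat.card F ^ (2 * k + 1)} =
      ENNReal.ofReal (∑ t ∈ Finset.range (n + 1),
        (fixCoeff (Nat.card F) t (2 * k) + fixCoeff (Nat.card F) t (2 * k + 1))) := by
  classical
  let _ : MeasurableSpace (Sp n F) := ⊤
  rw [PMF.toMeasure_map_apply _ _ _ measurable_from_top (MeasurableSet.of_discrete),
    PMF.toMeasure_uniformOfFintype_apply _ MeasurableSpace.measurableSet_top,
    Finset.sum_add_distrib, ← card_finrank_fixedSpace_eq, ← card_finrank_fixedSpace_eq, ← add_div,
    ENNReal.ofReal_div_of_pos (Nat.cast_pos.2 Fintype.card_pos), ENNReal.ofReal_natCast,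
    ← Nat.cast_add, ENNReal.ofReal_natCast]
  congr 2
  rw [← Finset.card_union_of_disjoint, ← Finset.filter_or, Fintype.card_subtype]
  · congr 1
    ext g
    rw [Finset.mem_filter, Finset.mem_filter, Set.mem_preimage, fixedVectorCount_eq,
      pow_natCard_mem_pair_iff]
  · rw [Finset.disjoint_filter]
    intro g _ h1 h2
    omega

theorem fixedVectorLaw_real_pair {a : ℝ} (ha0 : 0 ≤ a) (ha1 : a < 1) (k : ℕ) :
    (fixedVectorLaw F a ha0 ha1).toMeasure.real
        {Nat.card F ^ (2 * k), Nat.card F ^ (2 * k + 1)} =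
      alSalamCarlitzWeight (a / Nat.card F) (1 / (Nat.card F : ℝ) ^ 2) k := by
  have hs := hasSum_geometric_fixCoeff (one_lt_natCard_cast F) ha0 ha1 k
  have hnn : ∀ n, 0 ≤ ∑ t ∈ Finset.range (n + 1),
      (fixCoeff (Nat.card F) t (2 * k) + fixCoeff (Nat.card F) t (2 * k + 1)) := fun n => by
    classical
    rw [Finset.sum_add_distrib, ← card_finrank_fixedSpace_eq, ← card_finrank_fixedSpace_eq]
    positivity
  have h0 : ∀ n : ℕ, 0 ≤ (1 - a) * a ^ n := fun n =>
    mul_nonneg (sub_nonneg.mpr ha1.le) (pow_nonneg ha0 n)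
  rw [MeasureTheory.measureReal_def, fixedVectorLaw,
    PMF.toMeasure_bind_apply _ _ _ MeasurableSet.of_discrete]
  have e : ∀ n, geometricLaw a ha0 ha1 n *
      ((PMF.uniformOfFintype (Sp n F)).map fixedVectorCount).toMeasure
        {Nat.card F ^ (2 * k), Nat.card F ^ (2 * k + 1)} =
      ENNReal.ofReal ((1 - a) * a ^ n * ∑ t ∈ Finset.range (n + 1),
        (fixCoeff (Nat.card F) t (2 * k) + fixCoeff (Nat.card F) t (2 * k + 1))) := fun n => by
    rw [toMeasure_map_fixedVectorCount, ENNReal.ofReal_mul (h0 n)]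
    rfl
  simp only [e]
  rw [← ENNReal.ofReal_tsum_of_nonneg (fun n => mul_nonneg (h0 n) (hnn n)) hs.summable, hs.tsum_eq,
    ENNReal.toReal_ofReal]
  exact hs.nonneg fun n => mul_nonneg (h0 n) (hnn n)

theorem support_fixedVectorLaw_subset {a : ℝ} (ha0 : 0 ≤ a) (ha1 : a < 1) :
    (fixedVectorLaw F a ha0 ha1).support ⊆
      ⋃ k : ℕ, {Nat.card F ^ (2 * k), Nat.card F ^ (2 * k + 1)} := by
  intro z hz
  rw [fixedVectorLaw, PMF.mem_support_bind_iff] at hz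
  obtain ⟨n, -, hz⟩ := hz
  rw [PMF.mem_support_map_iff] at hz
  obtain ⟨g, -, rfl⟩ := hz
  refine Set.mem_iUnion.2 ⟨Module.finrank F (fixedSpace g) / 2, ?_⟩
  rw [fixedVectorCount_eq, pow_natCard_mem_pair_iff]
  omega

end

theorem mainTheorem9 (F : Type*) [Field F] [Finite F] (q : ℕ) (hq : Nat.card F = q)
    (a : ℝ) (ha0 : 0 ≤ a) (ha1 : a < 1) :
    (∀ k : ℕ,
      (fixedVectorLaw F a ha0 ha1).toMeasure.real {q ^ (2 * k), q ^ (2 * k + 1)} =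
        alSalamCarlitzWeight (a / q) (1 / (q : ℝ) ^ 2) k) ∧
    HasSum (fun k : ℕ => alSalamCarlitzWeight (a / q) (1 / (q : ℝ) ^ 2) k) 1 := by
  subst hq
  have h1 := fixedVectorLaw_real_pair (F := F) ha0 ha1
  refine ⟨h1, ?_⟩
  set μ := (fixedVectorLaw F a ha0 ha1).toMeasure with hμ
  -- No `q`-series identity is needed for the total mass: the pairs are disjoint and cover the
  -- support of a probability law.
  have hd : Pairwise (Function.onFun Disjoint fun k : ℕ =>
      ({Nat.card F ^ (2 * k), Nat.card F ^ (2 * k + 1)} : Set ℕ)) := by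
    intro k l hkl
    rw [Function.onFun, Set.disjoint_left]
    rintro _ (rfl | rfl) h
    all_goals
      rw [pow_natCard_mem_pair_iff] at h
      omega
  have h2 := MeasureTheory.measure_iUnion (μ := μ) hd fun _ => MeasurableSet.of_discrete
  rw [(PMF.toMeasure_apply_eq_one_iff _ MeasurableSet.of_discrete).2
    (support_fixedVectorLaw_subset ha0 ha1)] at h2
  have h3 := ENNReal.hasSum_toReal (h2 ▸ ENNReal.one_ne_top)
  have h4 : HasSum (fun k : ℕ => μ.real {Nat.card F ^ (2 * k), Nat.card F ^ (2 * k + 1)}) 1 := by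
    rw [← ENNReal.toReal_one, h2,
      ENNReal.tsum_toReal_eq fun _ => MeasureTheory.measure_ne_top μ _]
    exact h3
  simpa only [h1] using h4
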